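/- Let $\mathcal C$ be a pivotal fusion category over $\mathbb C$, with simple objects $V_0=\mathbf 1,\dots,V_m$ up to isomorphism, which is pseudo-unitary, i.e. $\sum_i \dim(V_i)\dim(V_i^*)=\sum_i \mathrm{FPdim}(V_i)^2$ (for example, a pseudo-unitary fusion category with its canonical spherical structure), and whose Grothendieck ring is commutative. For a fusion subcategory $\mathcal D\subseteq\mathcal C$ and $V\in\mathcal C$ let $Z_{\mathcal D}(V)=\int_{X\in\mathcal D}X\otimes V\otimes X^*$, with its comonad structure $\delta\colon Z_{\mathcal D}\to Z_{\mathcal D}^2$, and let $A_{\mathcal D}=Z_{\mathcal D}(\mathbf 1)$ be the adjoint algebra, with unit $u$ and multiplication $m$. Put $\mathrm{CF}(\mathcal D)=\mathrm{Hom}(A_{\mathcal D},\mathbf 1)$, with product $f\star g=f\circ Z_{\mathcal D}(g)\circ\delta_{\mathbf 1}$ (written as juxtaposition below), and $\mathrm{CE}(\mathcal C)=\mathrm{Hom}(\mathbf 1,A_{\mathcal C})\simeq\mathrm{End}(\mathrm{id}_{\mathcal C})$. The idempotent cointegral of $\mathcal D$ is the unique $t\in\mathrm{CF}(\mathcal D)$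 with $Z_{\mathcal D}(t)\circ\delta_{\mathbf 1}=u\circ t$ and $t\circ u=\mathrm{id}_{\mathbf 1}$; let $\lambda_{\mathcal D}\in\mathrm{CF}(\mathcal C)$ be its image under the inclusion $\mathrm{CF}(\mathcal D)\hookrightarrow\mathrm{CF}(\mathcal C)$ given by composition with the canonical map $A_{\mathcal C}\to A_{\mathcal D}$. Write $\lambda=\lambda_{\mathcal C}$. The Fourier transform $\mathcal F_\lambda\colon\mathrm{CE}(\mathcal C)\to\mathrm{CF}(\mathcal C)$, $a\mapsto\lambda\circ m\circ(\mathcal S(a)\otimes\mathrm{id})$, where $\mathcal S$ is the antipodal operator (given on $\mathrm{End}(\mathrm{id}_{\mathcal C})$ by $\xi\mapsto\xi^!$, $\xi^!_X=(\xi_{{}^*X})^*$), is bijective. Let $F_j$ be the primitive central idempotents of $\mathrm{CF}(\mathcal C)$, let $\bar{\mathcal C}_j=\mathcal F_\lambda^{-1}(F_j)$ be the conjugacy class sums, let $\ell_{\mathcal D}=\mathcal F_\lambda^{-1}(\lambda_{\mathcal D})$, and let $\mathcal L_{\mathcal D}$ be the unique set of indices with $\lambda_{\mathcal D}=\sum_{j\in\mathcal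 L_{\mathcal D}}F_j$. Then all these objects are well defined (for each fusion subcategory the idempotent cointegral and the index set exist and are unique, and $\mathcal F_\lambda$ is bijective), and for any two fusion subcategories $\mathcal D,\mathcal E\subseteq\mathcal C$, with $\mathcal D\vee\mathcal E$ the smallest fusion subcategory containing both, $$\lambda_{\mathcal D\vee\mathcal E}=\lambda_{\mathcal D}\lambda_{\mathcal E},\qquad \ell_{\mathcal D\vee\mathcal E}=\mathcal F_\lambda^{-1}(\lambda_{\mathcal D\vee\mathcal E})=\sum_{j\in\mathcal L_{\mathcal D}\cap\mathcal L_{\mathcal E}}\bar{\mathcal C}_j,\qquad \mathcal L_{\mathcal D\vee\mathcal E}=\mathcal L_{\mathcal D}\cap\mathcal L_{\mathcal E}.$$ -/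

import Mathlib

open CategoryTheory CategoryTheory.Limits MonoidalCategory Opposite

universe v u

namespace FusionCat

section Rigid

variable {C : Type u} [Category.{v} C] [MonoidalCategory C]

/-- Duals of morphisms are determined by the evaluation. -/
theorem dual_ext {X Y W : C} [ExactPairing X Y] {f g : W ⟶ Y}
    (h : f ▷ X ≫ ε_ X Y = g ▷ X ≫ ε_ X Y) : f = g := by
  have key : ∀ k : W ⟶ Y, tensorRightHomEquiv W X Y (𝟙_ C) (k ▷ X ≫ ε_ X Y) = k ≫ (λ_ Y).inv := by
    intro k
    let _ : HasRightDual X := ⟨Y⟩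
    exact tensorRightHomEquiv_whiskerRight_comp_evaluation (X := X) k
  have := congrArg (tensorRightHomEquiv W X Y (𝟙_ C)) h
  rw [key, key] at this
  exact (cancel_mono _).1 this

variable [RightRigidCategory C]

theorem rightDualTensorIso_hom_evaluation (X Y : C) :
    (rightDualTensorIso X Y).hom ▷ (X ⊗ Y) ≫ ε_ (X ⊗ Y) (Yᘁ ⊗ Xᘁ) = ε_ (X ⊗ Y) (X ⊗ Y)ᘁ := by
  have := @rightAdjointMate_comp_evaluation C _ _ (X ⊗ Y) (X ⊗ Y) ⟨Yᘁ ⊗ Xᘁ⟩ _ (𝟙 (X ⊗ Y))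
  rw [whiskerLeft_id, Category.id_comp] at this
  exact this

theorem dual_whiskerLeft (X : C) {Y Y' : C} (g : Y ⟶ Y') :
    (X ◁ g)ᘁ ≫ (rightDualTensorIso X Y).hom = (rightDualTensorIso X Y').hom ≫ gᘁ ▷ Xᘁ := by
  apply dual_ext (X := X ⊗ Y)
  rw [comp_whiskerRight, Category.assoc, rightDualTensorIso_hom_evaluation,
    rightAdjointMate_comp_evaluation, ← rightDualTensorIso_hom_evaluation, comp_whiskerRight,
    Category.assoc, whisker_exchange_assoc]
  congr 1
  rw [ExactPairing.tensor_evaluation, ExactPairing.tensor_evaluation]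
  calc
    _ = 𝟙 _ ⊗≫ ((Y'ᘁ : C) ◁ (ε_ X Xᘁ ▷ Y ≫ 𝟙_ C ◁ g)) ⊗≫ ε_ Y' Y'ᘁ := by
      rw [← whisker_exchange]; monoidal
    _ = 𝟙 _ ⊗≫ ((Y'ᘁ : C) ◁ (ε_ X Xᘁ ▷ Y)) ⊗≫ ((Y'ᘁ : C) ◁ g ≫ ε_ Y' Y'ᘁ) := by monoidal
    _ = 𝟙 _ ⊗≫ ((Y'ᘁ : C) ◁ (ε_ X Xᘁ ▷ Y)) ⊗≫ (gᘁ ▷ Y ≫ ε_ Y Yᘁ) := by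
      rw [rightAdjointMate_comp_evaluation]
    _ = 𝟙 _ ⊗≫ ((Y'ᘁ : C) ◁ (ε_ X Xᘁ ▷ Y) ≫ gᘁ ▷ (𝟙_ C ⊗ Y)) ⊗≫ ε_ Y Yᘁ := by monoidal
    _ = _ := by rw [whisker_exchange]; monoidal

theorem dual_whiskerRight {X X' : C} (f : X ⟶ X') (Y : C) :
    (f ▷ Y)ᘁ ≫ (rightDualTensorIso X Y).hom = (rightDualTensorIso X' Y).hom ≫ Yᘁ ◁ fᘁ := by
  apply dual_ext (X := X ⊗ Y)
  rw [comp_whiskerRight, Category.assoc, rightDualTensorIso_hom_evaluation,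
    rightAdjointMate_comp_evaluation, ← rightDualTensorIso_hom_evaluation, comp_whiskerRight,
    Category.assoc, whisker_exchange_assoc]
  congr 1
  rw [ExactPairing.tensor_evaluation, ExactPairing.tensor_evaluation]
  calc
    _ = 𝟙 _ ⊗≫ ((Yᘁ : C) ◁ (((X'ᘁ : C) ◁ f ≫ ε_ X' X'ᘁ) ▷ Y)) ⊗≫ ε_ Y Yᘁ := by monoidal
    _ = 𝟙 _ ⊗≫ ((Yᘁ : C) ◁ ((fᘁ ▷ X ≫ ε_ X Xᘁ) ▷ Y)) ⊗≫ ε_ Y Yᘁ := by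
      rw [rightAdjointMate_comp_evaluation]
    _ = _ := by monoidal

/-- The bijection `Hom(X* ⊗ W ⊗ X, B) ≃ Hom(W, X ⊗ B ⊗ X*)`. -/
def conjEquiv (X W B : C) : ((Xᘁ ⊗ W) ⊗ X ⟶ B) ≃ (W ⟶ X ⊗ (B ⊗ Xᘁ)) :=
  (tensorRightHomEquiv (Xᘁ ⊗ W) X Xᘁ B).trans (tensorLeftHomEquiv W X Xᘁ (B ⊗ Xᘁ))

theorem conjEquiv_comp {X W B B' : C} (f : (Xᘁ ⊗ W) ⊗ X ⟶ B) (g : B ⟶ B') :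
    conjEquiv X W B' (f ≫ g) = conjEquiv X W B f ≫ X ◁ (g ▷ Xᘁ) := by
  simp [conjEquiv, tensorRightHomEquiv_naturality, tensorLeftHomEquiv_naturality]

theorem conjEquiv_symm_comp {X W B B' : C} (f : W ⟶ X ⊗ (B ⊗ Xᘁ)) (g : B ⟶ B') :
    (conjEquiv X W B).symm f ≫ g = (conjEquiv X W B').symm (f ≫ X ◁ (g ▷ Xᘁ)) := by
  rw [Equiv.eq_symm_apply, conjEquiv_comp, Equiv.apply_symm_apply]

end Rigid

section DualLinear

variable {C : Type u} [Category.{v} C] [Preadditive C] [MonoidalCategory C]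
  [MonoidalPreadditive C] [RightRigidCategory C]

theorem dual_sum {X Y : C} {ι : Type*} (s : Finset ι) (f : ι → (X ⟶ Y)) :
    (∑ i ∈ s, f i)ᘁ = ∑ i ∈ s, (f i)ᘁ := by
  simp [rightAdjointMate, Preadditive.comp_sum, Preadditive.sum_comp, whiskerLeft_sum,
    sum_whiskerRight]

theorem dual_smul [Linear ℂ C] [MonoidalLinear ℂ C] {X Y : C} (c : ℂ) (f : X ⟶ Y) : (c • f)ᘁ = c • fᘁ := by
  simp [rightAdjointMate]

end DualLinear

section EndExists

theorem hasEnd_of_decomposition {J : Type*} [Category* J] [Preadditive J]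
    {C : Type*} [Category* C] [Preadditive C] [HasFiniteProducts C]
    (F : Jᵒᵖ ⥤ J ⥤ C) {ι : Type*} [Finite ι] (S : ι → J)
    (hF : ∀ (X Y Y' : J) (n : ℕ) (g : Fin n → (Y ⟶ Y')),
      (F.obj (op X)).map (∑ k, g k) = ∑ k, (F.obj (op X)).map (g k))
    (hF' : ∀ (X X' Y : J) (n : ℕ) (g : Fin n → (X ⟶ X')),
      (F.map (∑ k, g k).op).app Y = ∑ k, (F.map (g k).op).app Y)
    (hS : ∀ (i j : ι) (φ : S i ⟶ S j) (W : C) (w : ∀ i, W ⟶ (F.obj (op (S i))).obj (S i)),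
      w i ≫ (F.obj (op (S i))).map φ = w j ≫ (F.map φ.op).app (S j))
    (hdec : ∀ X : J, ∃ (n : ℕ) (a : Fin n → ι) (p : ∀ k, X ⟶ S (a k)) (q : ∀ k, S (a k) ⟶ X),
      ∑ k, p k ≫ q k = 𝟙 X) : HasEnd F := by
  classical
  choose n a p q hpq using hdec
  let P : C := ∏ᶜ fun i => (F.obj (op (S i))).obj (S i)
  let pr : ∀ i, P ⟶ (F.obj (op (S i))).obj (S i) := fun i => Pi.π _ i
  let π : ∀ X : J, P ⟶ (F.obj (op X)).obj X := fun X =>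
    ∑ k, pr (a X k) ≫ (F.map (p X k).op).app (S (a X k)) ≫ (F.obj (op X)).map (q X k)
  have dinat : ∀ ⦃X Y : J⦄ (f : X ⟶ Y),
      π X ≫ (F.obj (op X)).map f = π Y ≫ (F.map f.op).app Y := by
    intro X Y f
    have h1 : ∀ k, q X k ≫ f = ∑ l, (q X k ≫ f ≫ p Y l) ≫ q Y l := by
      intro k
      simp only [Category.assoc, ← Preadditive.comp_sum, hpq, Category.comp_id]
    have h2 : ∀ l, f ≫ p Y l = ∑ k, p X k ≫ (q X k ≫ f ≫ p Y l) := by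
      intro l
      simp only [← Category.assoc, ← Preadditive.sum_comp, hpq, Category.id_comp]
    have e1 : π X ≫ (F.obj (op X)).map f = ∑ k, ∑ l, pr (a X k) ≫
        (F.obj (op (S (a X k)))).map (q X k ≫ f ≫ p Y l) ≫ (F.map (p X k).op).app _ ≫
          (F.obj (op X)).map (q Y l) := by
      simp only [π, Preadditive.sum_comp, Category.assoc, ← Functor.map_comp]
      refine Finset.sum_congr rfl fun k _ => ?_
      rw [h1, hF, Preadditive.comp_sum, Preadditive.comp_sum]
      refine Finset.sum_congr rfl fun l _ => ?_
      rw [Functor.map_comp, NatTrans.naturality_assoc]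
    have e2 : π Y ≫ (F.map f.op).app Y = ∑ l, ∑ k, pr (a Y l) ≫
        (F.map (q X k ≫ f ≫ p Y l).op).app _ ≫ (F.map (p X k).op).app _ ≫
          (F.obj (op X)).map (q Y l) := by
      simp only [π, Preadditive.sum_comp, Category.assoc]
      refine Finset.sum_congr rfl fun l _ => ?_
      have h3 : (F.map (f ≫ p Y l).op).app (S (a Y l)) =
          ∑ k, (F.map (p X k ≫ (q X k ≫ f ≫ p Y l)).op).app (S (a Y l)) := by
        rw [← hF', ← h2]
      rw [NatTrans.naturality, ← NatTrans.comp_app_assoc, ← Functor.map_comp, ← op_comp, h3,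
        Preadditive.sum_comp, Preadditive.comp_sum]
      refine Finset.sum_congr rfl fun k _ => ?_
      rw [op_comp, Functor.map_comp, NatTrans.comp_app, Category.assoc]
    rw [e1, e2, Finset.sum_comm]
    refine Finset.sum_congr rfl fun l _ => Finset.sum_congr rfl fun k _ => ?_
    have := hS _ _ (q X k ≫ f ≫ p Y l) P pr
    rw [reassoc_of% this]
  have hπS : ∀ i, π (S i) = pr i := by
    intro i
    simp only [π]
    have : ∀ k, pr (a (S i) k) ≫ (F.map (p (S i) k).op).app (S (a (S i) k)) ≫
        (F.obj (op (S i))).map (q (S i) k) =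
        pr i ≫ (F.obj (op (S i))).map (p (S i) k ≫ q (S i) k) := by
      intro k
      have := hS _ _ (p (S i) k) P pr
      rw [← reassoc_of% this, Functor.map_comp]
    simp only [this]
    rw [← Preadditive.comp_sum, ← hF, hpq]
    simp
  have fac : ∀ (W : C) (w : ∀ X : J, W ⟶ (F.obj (op X)).obj X)
      (_ : ∀ ⦃X Y : J⦄ (f : X ⟶ Y), w X ≫ (F.obj (op X)).map f = w Y ≫ (F.map f.op).app Y)
      (X : J), (Pi.lift fun i => w (S i) : W ⟶ P) ≫ π X = w X := by
    intro W w hw X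
    have h : ∀ k, (Pi.lift fun i => w (S i) : W ⟶ P) ≫ pr (a X k) ≫
        (F.map (p X k).op).app (S (a X k)) ≫ (F.obj (op X)).map (q X k) =
        w X ≫ (F.obj (op X)).map (p X k ≫ q X k) := by
      intro k
      have h0 : (Pi.lift fun i => w (S i) : W ⟶ P) ≫ pr (a X k) = w (S (a X k)) :=
        Pi.lift_π _ _
      have h1 := hw (p X k)
      rw [reassoc_of% h0, ← reassoc_of% h1, Functor.map_comp]
    simp only [π, Preadditive.comp_sum, h]
    rw [← Preadditive.comp_sum, ← hF, hpq, CategoryTheory.Functor.map_id, Category.comp_id]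
  have uniq : ∀ (W : C) (w : ∀ X : J, W ⟶ (F.obj (op X)).obj X) (m : W ⟶ P),
      (∀ X : J, m ≫ π X = w X) → m = Pi.lift fun i => w (S i) := by
    intro W w m hm
    refine Pi.hom_ext _ _ fun i => ?_
    have h := hm (S i)
    rw [hπS] at h
    exact h.trans (Pi.lift_π (fun i => w (S i)) i).symm
  exact ⟨⟨⟨Wedge.mk P π dinat, Multifork.IsLimit.mk _ (fun W => Pi.lift fun i => W.ι (S i))
    (fun W => fac W.pt W.ι fun _ _ f => Wedge.condition W f)
    (fun W m hm => uniq W.pt W.ι m hm)⟩⟩⟩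

end EndExists
section Irr

variable (C : Type u) [Category.{v} C] [Preadditive C]

/-- Isomorphism of simple objects. -/
instance simpleSetoid : Setoid {X : C // Simple X} where
  r X Y := Nonempty (X.1 ≅ Y.1)
  iseqv := ⟨fun _ => ⟨Iso.refl _⟩, fun ⟨e⟩ => ⟨e.symm⟩, fun ⟨e⟩ ⟨f⟩ => ⟨e ≪≫ f⟩⟩

/-- The set of isomorphism classes of simple objects. -/
def Irr : Type _ := Quotient (simpleSetoid C)

variable {C} in
/-- A representative of an isomorphism class of simple objects. -/
noncomputable def Irr.rep (i : Irr C) : C := (Quotient.out i).1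

variable {C} in
theorem Irr.simple_rep (i : Irr C) : Simple i.rep := (Quotient.out i).2

variable {C} in
theorem Irr.exists_iso_rep (X : C) (hX : Simple X) : ∃ i : Irr C, Nonempty (X ≅ i.rep) :=
  ⟨Quotient.mk _ ⟨X, hX⟩, (Quotient.exact (Quotient.out_eq
    (Quotient.mk (simpleSetoid C) ⟨X, hX⟩))).map Iso.symm⟩

variable {C} in
theorem Irr.rep_injective {i j : Irr C} (e : i.rep ≅ j.rep) : i = j := by
  rw [← Quotient.out_eq i, ← Quotient.out_eq j]
  exact Quotient.sound ⟨e⟩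

end Irr

section Basic

instance hasFiniteBiproducts_of_abelian (C : Type u) [Category.{v} C] [Abelian C] :
    HasFiniteBiproducts C := Abelian.hasFiniteBiproducts

variable (C : Type u) [Category.{v} C] [Abelian C] [Linear ℂ C] [MonoidalCategory C]
  [MonoidalPreadditive C] [MonoidalLinear ℂ C] [RigidCategory C]

/-- A fusion category over `ℂ`: a `ℂ`-linear abelian rigid monoidal category with bilinear tensor
product, finite dimensional morphism spaces, finitely many isomorphism classes of simple objects,
in which every object is a finite direct sum of simple objects, and with `End(𝟙) = ℂ`. -/
class IsFusionCategory : Prop where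
  finrank_end_unit : Module.finrank ℂ (𝟙_ C ⟶ 𝟙_ C) = 1
  finiteDimensional_hom (X Y : C) : FiniteDimensional ℂ (X ⟶ Y)
  finite_irr : Finite (Irr C)
  semisimple (X : C) : ∃ (n : ℕ) (S : Fin n → C), (∀ k, Simple (S k)) ∧ Nonempty (X ≅ ⨁ S)

attribute [instance] IsFusionCategory.finiteDimensional_hom IsFusionCategory.finite_irr

/-- A fusion subcategory, given by its class of objects: a full subcategory closed under finite
direct sums, direct summands (hence isomorphisms), tensor products and duals, and containing the
unit object. -/
@[ext]
structure FusionSubcategory where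
  carrier : ObjectProperty C
  unit : carrier (𝟙_ C)
  tensor {X Y : C} : carrier X → carrier Y → carrier (X ⊗ Y)
  rightDual {X : C} : carrier X → carrier (Xᘁ)
  leftDual {X : C} : carrier X → carrier (HasLeftDual.leftDual X)
  biprod {X Y : C} : carrier X → carrier Y → carrier (X ⊞ Y)
  summand {X Y : C} : Retract X Y → carrier Y → carrier X

namespace FusionSubcategory

/-- The whole category. -/
def top : FusionSubcategory C where
  carrier _ := True
  unit := trivial
  tensor _ _ := trivial
  rightDual _ := trivial
  leftDual _ := trivial
  biprod _ _ := trivial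
  summand _ _ := trivial

variable {C}

/-- The fusion subcategory `D ∨ E` generated by `D` and `E`, i.e. the smallest fusion subcategory
which contains `D` and `E`. -/
def join (D E : FusionSubcategory C) : FusionSubcategory C where
  carrier X := ∀ K : FusionSubcategory C, D.carrier ≤ K.carrier → E.carrier ≤ K.carrier →
    K.carrier X
  unit K _ _ := K.unit
  tensor hX hY K hD hE := K.tensor (hX K hD hE) (hY K hD hE)
  rightDual hX K hD hE := K.rightDual (hX K hD hE)
  leftDual hX K hD hE := K.leftDual (hX K hD hE)
  biprod hX hY K hD hE := K.biprod (hX K hD hE) (hY K hD hE)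
  summand r hY K hD hE := K.summand r (hY K hD hE)

end FusionSubcategory

end Basic

section Ends

variable {C : Type u} [Category.{v} C] [Abelian C] [Linear ℂ C] [MonoidalCategory C]
  [MonoidalPreadditive C] [MonoidalLinear ℂ C] [RigidCategory C]

/-- The functor `(X, Y) ↦ Y ⊗ V ⊗ X*` on `Dᵒᵖ × D`. -/
def conjFunctor (D : FusionSubcategory C) (V : C) :
    D.carrier.FullSubcategoryᵒᵖ ⥤ D.carrier.FullSubcategory ⥤ C where
  obj X :=
    { obj := fun Y => Y.obj ⊗ (V ⊗ X.unop.objᘁ)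
      map := fun g => g.hom ▷ _ }
  map f := { app := fun Y => Y.obj ◁ (V ◁ f.unop.homᘁ)
             naturality := fun Y Y' g => (whisker_exchange _ _).symm }
  map_id X := by ext; simp
  map_comp f g := by ext; simp [comp_rightAdjointMate]

theorem FusionSubcategory.exists_decomposition [IsFusionCategory C] (D : FusionSubcategory C)
    (X : D.carrier.FullSubcategory) :
    ∃ (n : ℕ) (a : Fin n → {i : Irr C // D.carrier i.rep})
      (p : ∀ k, X ⟶ (⟨(a k).1.rep, (a k).2⟩ : D.carrier.FullSubcategory))
      (q : ∀ k, (⟨(a k).1.rep, (a k).2⟩ : D.carrier.FullSubcategory) ⟶ X),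
      ∑ k, p k ≫ q k = 𝟙 X := by
  obtain ⟨n, S, hS, ⟨e⟩⟩ := IsFusionCategory.semisimple X.obj
  choose a f using fun k => Irr.exists_iso_rep (S k) (hS k)
  have f' : ∀ k, S k ≅ (a k).rep := fun k => (f k).some
  have r : ∀ k, Retract ((a k).rep) X.obj := fun k =>
    { i := (f' k).inv ≫ biproduct.ι S k ≫ e.inv
      r := e.hom ≫ biproduct.π S k ≫ (f' k).hom }
  refine ⟨n, fun k => ⟨a k, D.summand (r k) X.property⟩,
    fun k => ObjectProperty.homMk (e.hom ≫ biproduct.π S k ≫ (f' k).hom),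
    fun k => ObjectProperty.homMk ((f' k).inv ≫ biproduct.ι S k ≫ e.inv), ?_⟩
  apply D.carrier.ι.map_injective
  rw [Functor.map_sum]
  simp only [ObjectProperty.ι_map, ObjectProperty.FullSubcategory.comp_hom,
    ObjectProperty.homMk_hom, Category.assoc, Iso.hom_inv_id_assoc,
    ObjectProperty.FullSubcategory.id_hom]
  rw [← Preadditive.comp_sum]
  simp only [← Category.assoc]
  rw [← Preadditive.sum_comp, biproduct.total]
  simp

theorem Irr.hom_eq [IsFusionCategory C] {i j : Irr C} (φ : i.rep ⟶ j.rep) :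
    φ = 0 ∨ ∃ (h : i = j) (c : ℂ), φ = c • eqToHom (congrArg Irr.rep h) := by
  have := i.simple_rep
  have := j.simple_rep
  by_cases hφ : φ = 0
  · exact Or.inl hφ
  · right
    have := isIso_of_hom_simple hφ
    have h : i = j := Irr.rep_injective (asIso φ)
    subst h
    obtain ⟨c, hc⟩ := endomorphism_simple_eq_smul_id ℂ φ
    exact ⟨rfl, c, by simp [← hc]⟩

instance hasEnd_conjFunctor [IsFusionCategory C] (D : FusionSubcategory C) (V : C) :
    HasEnd (conjFunctor D V) := by
  refine hasEnd_of_decomposition (conjFunctor D V)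
    (fun i : {i : Irr C // D.carrier i.rep} => ⟨i.1.rep, i.2⟩) ?_ ?_ ?_ D.exists_decomposition
  · intro X Y Y' n g
    have : (∑ k, g k).hom = ∑ k, (g k).hom := D.carrier.ι.map_sum g Finset.univ
    simp only [conjFunctor, this, sum_whiskerRight]
    rfl
  · intro X X' Y n g
    have : (∑ k, g k).hom = ∑ k, (g k).hom := D.carrier.ι.map_sum g Finset.univ
    simp only [conjFunctor, Quiver.Hom.unop_op, this, dual_sum, whiskerLeft_sum]
    rfl
  · intro i j φ W w
    obtain ⟨i, hi⟩ := i
    obtain ⟨j, hj⟩ := j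
    have key : ∀ f : i.rep ⟶ j.rep, w ⟨i, hi⟩ ≫ f ▷ (V ⊗ i.repᘁ) =
        w ⟨j, hj⟩ ≫ j.rep ◁ (V ◁ fᘁ) := by
      intro f
      rcases Irr.hom_eq f with h0 | ⟨h, c, hc⟩
      · subst h0
        have h : (0 : i.rep ⟶ j.rep)ᘁ = 0 := by simp [rightAdjointMate]
        rw [h]
        simp only [MonoidalPreadditive.zero_whiskerRight, MonoidalPreadditive.whiskerLeft_zero]
        exact comp_zero.trans comp_zero.symm
      · subst h
        rw [eqToHom_refl] at hc
        rw [hc, dual_smul]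
        simp
    exact key φ.hom

end Ends

section Adjoint

variable {C : Type u} [Category.{v} C] [Abelian C] [Linear ℂ C] [MonoidalCategory C]
  [MonoidalPreadditive C] [MonoidalLinear ℂ C] [RigidCategory C] [IsFusionCategory C]

/-- The end `Z(V) = ∫_{X ∈ D} X ⊗ V ⊗ X*`. -/
noncomputable def Z (D : FusionSubcategory C) (V : C) : C := end_ (conjFunctor D V)

namespace Z

variable (D : FusionSubcategory C) (V : C)

/-- The universal dinatural maps `Z(V) ⟶ X ⊗ V ⊗ X*`, for `X ∈ D`. -/
noncomputable def π (X : C) (hX : D.carrier X) : Z D V ⟶ X ⊗ (V ⊗ Xᘁ) :=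
  end_.π (conjFunctor D V) ⟨X, hX⟩

variable {D V}

theorem condition {X Y : C} (hX : D.carrier X) (hY : D.carrier Y) (f : X ⟶ Y) :
    π D V X hX ≫ f ▷ (V ⊗ Xᘁ) = π D V Y hY ≫ Y ◁ (V ◁ fᘁ) :=
  end_.condition (conjFunctor D V) (i := ⟨X, hX⟩) (j := ⟨Y, hY⟩) (ObjectProperty.homMk f)

theorem hom_ext {W : C} {f g : W ⟶ Z D V}
    (h : ∀ (X : C) (hX : D.carrier X), f ≫ π D V X hX = g ≫ π D V X hX) : f = g :=
  end_.hom_ext fun X => h X.obj X.property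

/-- The morphism into the end which is induced by a dinatural family. -/
noncomputable def lift {W : C} (w : ∀ (X : C), D.carrier X → (W ⟶ X ⊗ (V ⊗ Xᘁ)))
    (hw : ∀ (X Y : C) (hX : D.carrier X) (hY : D.carrier Y) (f : X ⟶ Y),
      w X hX ≫ f ▷ (V ⊗ Xᘁ) = w Y hY ≫ Y ◁ (V ◁ fᘁ)) : W ⟶ Z D V :=
  end_.lift (F := conjFunctor D V) (fun X => w X.obj X.property)
    (fun X Y f => hw X.obj Y.obj X.property Y.property f.hom)

theorem lift_π {W : C} (w : ∀ (X : C), D.carrier X → (W ⟶ X ⊗ (V ⊗ Xᘁ)))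
    (hw : ∀ (X Y : C) (hX : D.carrier X) (hY : D.carrier Y) (f : X ⟶ Y),
      w X hX ≫ f ▷ (V ⊗ Xᘁ) = w Y hY ≫ Y ◁ (V ◁ fᘁ)) (X : C) (hX : D.carrier X) :
    lift w hw ≫ π D V X hX = w X hX :=
  end_.lift_π (F := conjFunctor D V) _ _ _

variable (D) in
/-- The functor `Z` on morphisms. -/
noncomputable def map {V V' : C} (g : V ⟶ V') : Z D V ⟶ Z D V' :=
  lift (fun X hX => π D V X hX ≫ X ◁ (g ▷ Xᘁ)) (by
    intro X Y hX hY f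
    rw [Category.assoc, Category.assoc, whisker_exchange, ← Category.assoc, condition hX hY,
      Category.assoc, ← MonoidalCategory.whiskerLeft_comp, ← MonoidalCategory.whiskerLeft_comp,
      whisker_exchange])

/-- `X ⊗ Z(V) ⊗ X*` is the end of `X ⊗ (Y ⊗ V ⊗ Y*) ⊗ X*` over `Y`: the morphism induced by a
dinatural family. -/
noncomputable def conjLift (X : C) {W : C}
    (w : ∀ (Y : C), D.carrier Y → (W ⟶ X ⊗ ((Y ⊗ (V ⊗ Yᘁ)) ⊗ Xᘁ)))
    (hw : ∀ (Y Y' : C) (hY : D.carrier Y) (hY' : D.carrier Y') (g : Y ⟶ Y'),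
      w Y hY ≫ X ◁ ((g ▷ (V ⊗ Yᘁ)) ▷ Xᘁ) = w Y' hY' ≫ X ◁ ((Y' ◁ (V ◁ gᘁ)) ▷ Xᘁ)) :
    W ⟶ X ⊗ (Z D V ⊗ Xᘁ) :=
  conjEquiv X W (Z D V) (lift (fun Y hY => (conjEquiv X W _).symm (w Y hY)) (by
    intro Y Y' hY hY' g
    rw [conjEquiv_symm_comp, conjEquiv_symm_comp, hw Y Y' hY hY' g]))

theorem conjLift_π (X : C) {W : C}
    (w : ∀ (Y : C), D.carrier Y → (W ⟶ X ⊗ ((Y ⊗ (V ⊗ Yᘁ)) ⊗ Xᘁ)))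
    (hw : ∀ (Y Y' : C) (hY : D.carrier Y) (hY' : D.carrier Y') (g : Y ⟶ Y'),
      w Y hY ≫ X ◁ ((g ▷ (V ⊗ Yᘁ)) ▷ Xᘁ) = w Y' hY' ≫ X ◁ ((Y' ◁ (V ◁ gᘁ)) ▷ Xᘁ))
    (Y : C) (hY : D.carrier Y) :
    conjLift X w hw ≫ X ◁ (π D V Y hY ▷ Xᘁ) = w Y hY := by
  rw [conjLift, ← conjEquiv_comp, lift_π, Equiv.apply_symm_apply]

theorem conj_hom_ext {X X' W : C} {f g : W ⟶ X' ⊗ (Z D V ⊗ Xᘁ)}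
    (h : ∀ (Y : C) (hY : D.carrier Y),
      f ≫ X' ◁ (π D V Y hY ▷ Xᘁ) = g ≫ X' ◁ (π D V Y hY ▷ Xᘁ)) : f = g := by
  apply (tensorLeftHomEquiv W X' X'ᘁ (Z D V ⊗ Xᘁ)).symm.injective
  apply (tensorRightHomEquiv (X'ᘁ ⊗ W) X Xᘁ (Z D V)).symm.injective
  apply hom_ext
  intro Y hY
  have e1 : ∀ k : W ⟶ X' ⊗ (Z D V ⊗ Xᘁ),
      (tensorRightHomEquiv (X'ᘁ ⊗ W) X Xᘁ (Z D V)).symm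
        ((tensorLeftHomEquiv W X' X'ᘁ (Z D V ⊗ Xᘁ)).symm k) ≫ π D V Y hY =
      (tensorRightHomEquiv (X'ᘁ ⊗ W) X Xᘁ _).symm
        ((tensorLeftHomEquiv W X' X'ᘁ (_ ⊗ Xᘁ)).symm (k ≫ X' ◁ (π D V Y hY ▷ Xᘁ))) := by
    intro k
    rw [Equiv.eq_symm_apply, Equiv.eq_symm_apply, tensorRightHomEquiv_naturality,
      tensorLeftHomEquiv_naturality, Equiv.apply_symm_apply, Equiv.apply_symm_apply]
  rw [e1, e1, h Y hY]

variable (D V)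

/-- The maps `π_{X ⊗ Y}`, with the canonical identification
`(X ⊗ Y) ⊗ V ⊗ (X ⊗ Y)* = X ⊗ (Y ⊗ V ⊗ Y*) ⊗ X*`. -/
noncomputable def πTensor (X Y : C) (hX : D.carrier X) (hY : D.carrier Y) :
    Z D V ⟶ X ⊗ ((Y ⊗ (V ⊗ Yᘁ)) ⊗ Xᘁ) :=
  π D V (X ⊗ Y) (D.tensor hX hY) ≫ (X ⊗ Y) ◁ (V ◁ (rightDualTensorIso X Y).hom) ⊗≫ 𝟙 _

theorem πTensor_right (X Y Y' : C) (hX : D.carrier X) (hY : D.carrier Y) (hY' : D.carrier Y')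
    (g : Y ⟶ Y') :
    πTensor D V X Y hX hY ≫ X ◁ ((g ▷ (V ⊗ Yᘁ)) ▷ Xᘁ) =
      πTensor D V X Y' hX hY' ≫ X ◁ ((Y' ◁ (V ◁ gᘁ)) ▷ Xᘁ) := by
  have h := condition (V := V) (D.tensor hX hY) (D.tensor hX hY') (X ◁ g)
  calc
    _ = π D V (X ⊗ Y) (D.tensor hX hY) ≫ ((X ⊗ Y) ◁ (V ◁ (rightDualTensorIso X Y).hom) ≫
          (X ◁ g) ▷ (V ⊗ (Yᘁ ⊗ Xᘁ))) ⊗≫ 𝟙 _ := by rw [πTensor]; monoidal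
    _ = (π D V (X ⊗ Y) (D.tensor hX hY) ≫ (X ◁ g) ▷ (V ⊗ (X ⊗ Y)ᘁ)) ≫
          (X ⊗ Y') ◁ (V ◁ (rightDualTensorIso X Y).hom) ⊗≫ 𝟙 _ := by
      rw [whisker_exchange]; monoidal
    _ = π D V (X ⊗ Y') (D.tensor hX hY') ≫
          (X ⊗ Y') ◁ (V ◁ ((X ◁ g)ᘁ ≫ (rightDualTensorIso X Y).hom)) ⊗≫ 𝟙 _ := by
      rw [h]; monoidal
    _ = π D V (X ⊗ Y') (D.tensor hX hY') ≫
          (X ⊗ Y') ◁ (V ◁ ((rightDualTensorIso X Y').hom ≫ gᘁ ▷ Xᘁ)) ⊗≫ 𝟙 _ := by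
      rw [dual_whiskerLeft]
    _ = _ := by rw [πTensor]; monoidal

theorem πTensor_left (X X' Y : C) (hX : D.carrier X) (hX' : D.carrier X') (hY : D.carrier Y)
    (f : X ⟶ X') :
    πTensor D V X Y hX hY ≫ f ▷ ((Y ⊗ (V ⊗ Yᘁ)) ⊗ Xᘁ) =
      πTensor D V X' Y hX' hY ≫ X' ◁ ((Y ⊗ (V ⊗ Yᘁ)) ◁ fᘁ) := by
  have h := condition (V := V) (D.tensor hX hY) (D.tensor hX' hY) (f ▷ Y)
  calc
    _ = π D V (X ⊗ Y) (D.tensor hX hY) ≫ ((X ⊗ Y) ◁ (V ◁ (rightDualTensorIso X Y).hom) ≫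
          (f ▷ Y) ▷ (V ⊗ (Yᘁ ⊗ Xᘁ))) ⊗≫ 𝟙 _ := by rw [πTensor]; monoidal
    _ = (π D V (X ⊗ Y) (D.tensor hX hY) ≫ (f ▷ Y) ▷ (V ⊗ (X ⊗ Y)ᘁ)) ≫
          (X' ⊗ Y) ◁ (V ◁ (rightDualTensorIso X Y).hom) ⊗≫ 𝟙 _ := by
      rw [whisker_exchange]; monoidal
    _ = π D V (X' ⊗ Y) (D.tensor hX' hY) ≫
          (X' ⊗ Y) ◁ (V ◁ ((f ▷ Y)ᘁ ≫ (rightDualTensorIso X Y).hom)) ⊗≫ 𝟙 _ := by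
      rw [h]; monoidal
    _ = π D V (X' ⊗ Y) (D.tensor hX' hY) ≫
          (X' ⊗ Y) ◁ (V ◁ ((rightDualTensorIso X' Y).hom ≫ Yᘁ ◁ fᘁ)) ⊗≫ 𝟙 _ := by
      rw [dual_whiskerRight]
    _ = _ := by rw [πTensor]; monoidal

/-- The comultiplication `δ_V : Z(V) ⟶ Z(Z(V))` of the comonad `Z`; see `comul_π` for its
characterisation. -/
noncomputable def comul : Z D V ⟶ Z D (Z D V) :=
  lift (fun X hX => conjLift X (fun Y hY => πTensor D V X Y hX hY)
      (fun Y Y' hY hY' g => πTensor_right D V X Y Y' hX hY hY' g)) (by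
    intro X X' hX hX' f
    apply conj_hom_ext
    intro Y hY
    rw [Category.assoc, Category.assoc, ← whisker_exchange, ← Category.assoc, conjLift_π,
      ← MonoidalCategory.whiskerLeft_comp, whisker_exchange, MonoidalCategory.whiskerLeft_comp,
      ← Category.assoc, conjLift_π, πTensor_left])

/-- The defining property of `δ`: `(id_X ⊗ π_Y ⊗ id_{X*}) ∘ π_X ∘ δ_V = π_{X ⊗ Y}`. -/
theorem comul_π (X Y : C) (hX : D.carrier X) (hY : D.carrier Y) :
    comul D V ≫ π D (Z D V) X hX ≫ X ◁ (π D V Y hY ▷ Xᘁ) =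
      π D V (X ⊗ Y) (D.tensor hX hY) ≫
        (X ⊗ Y) ◁ (V ◁ (rightDualTensorIso X Y).hom) ⊗≫ 𝟙 _ := by
  rw [comul, ← Category.assoc, lift_π, conjLift_π, πTensor]

end Z

variable (D : FusionSubcategory C)

/-- The adjoint algebra `A = Z(𝟙)` of `D`. -/
noncomputable abbrev A : C := Z D (𝟙_ C)

/-- The unit `u : 𝟙 ⟶ A`, given by `π_X ∘ u = coev_X`. -/
noncomputable def unitA : 𝟙_ C ⟶ A D :=
  Z.lift (fun X _ => η_ X Xᘁ ≫ X ◁ (λ_ Xᘁ).inv) (by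
    intro X Y _ _ f
    have h := coevaluation_comp_rightAdjointMate f
    calc
      _ = (η_ X Xᘁ ≫ f ▷ Xᘁ) ⊗≫ 𝟙 _ := by
        rw [Category.assoc, whisker_exchange]; monoidal
      _ = (η_ Y Yᘁ ≫ Y ◁ fᘁ) ⊗≫ 𝟙 _ := by rw [h]
      _ = _ := by monoidal)

/-- The multiplication `m : A ⊗ A ⟶ A`, given by
`π_X ∘ m = (id_X ⊗ ev_X ⊗ id_{X*}) ∘ (π_X ⊗ π_X)`. -/
noncomputable def mulA : A D ⊗ A D ⟶ A D :=
  Z.lift (fun X hX => (Z.π D (𝟙_ C) X hX ⊗ₘ Z.π D (𝟙_ C) X hX) ⊗≫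
      X ◁ (ε_ X Xᘁ ▷ (𝟙_ C ⊗ Xᘁ)) ⊗≫ 𝟙 _) (by
    intro X Y hX hY f
    have hc := Z.condition (V := 𝟙_ C) hX hY f
    have he := rightAdjointMate_comp_evaluation f
    generalize Z.π D (𝟙_ C) X hX = P at *
    generalize Z.π D (𝟙_ C) Y hY = Q at *
    rw [MonoidalCategory.tensorHom_def, MonoidalCategory.tensorHom_def]
    calc
      _ = (P ▷ A D ≫ (X ⊗ (𝟙_ C ⊗ Xᘁ)) ◁ P) ⊗≫ (X ◁ (ε_ X Xᘁ ▷ (𝟙_ C ⊗ Xᘁ)) ≫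
          f ▷ (𝟙_ C ⊗ 𝟙_ C ⊗ Xᘁ)) ⊗≫ 𝟙 _ := by monoidal
      _ = (P ▷ A D ≫ ((X ⊗ (𝟙_ C ⊗ Xᘁ)) ◁ P ≫ (f ▷ (𝟙_ C ⊗ Xᘁ)) ▷ (X ⊗ (𝟙_ C ⊗ Xᘁ)))) ⊗≫
          Y ◁ (ε_ X Xᘁ ▷ (𝟙_ C ⊗ Xᘁ)) ⊗≫ 𝟙 _ := by
        rw [whisker_exchange]; monoidal
      _ = ((P ≫ f ▷ (𝟙_ C ⊗ Xᘁ)) ▷ A D ≫ (Y ⊗ (𝟙_ C ⊗ Xᘁ)) ◁ P) ⊗≫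
          Y ◁ (ε_ X Xᘁ ▷ (𝟙_ C ⊗ Xᘁ)) ⊗≫ 𝟙 _ := by
        rw [whisker_exchange]; monoidal
      _ = (Q ▷ A D ≫ ((Y ◁ (𝟙_ C ◁ fᘁ)) ▷ A D ≫ (Y ⊗ (𝟙_ C ⊗ Xᘁ)) ◁ P)) ⊗≫
          Y ◁ (ε_ X Xᘁ ▷ (𝟙_ C ⊗ Xᘁ)) ⊗≫ 𝟙 _ := by
        rw [hc]; monoidal
      _ = (Q ▷ A D ≫ (Y ⊗ (𝟙_ C ⊗ Yᘁ)) ◁ P) ⊗≫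
          Y ◁ ((fᘁ ▷ X ≫ ε_ X Xᘁ) ▷ (𝟙_ C ⊗ Xᘁ)) ⊗≫ 𝟙 _ := by
        rw [← whisker_exchange]; monoidal
      _ = (Q ▷ A D ≫ (Y ⊗ (𝟙_ C ⊗ Yᘁ)) ◁ (P ≫ f ▷ (𝟙_ C ⊗ Xᘁ))) ⊗≫
          Y ◁ (ε_ Y Yᘁ ▷ (𝟙_ C ⊗ Xᘁ)) ⊗≫ 𝟙 _ := by
        rw [he]; monoidal
      _ = (Q ▷ A D ≫ (Y ⊗ (𝟙_ C ⊗ Yᘁ)) ◁ Q) ⊗≫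
          Y ◁ ((Yᘁ ⊗ Y) ◁ (𝟙_ C ◁ fᘁ) ≫ ε_ Y Yᘁ ▷ (𝟙_ C ⊗ Xᘁ)) ⊗≫ 𝟙 _ := by
        rw [hc]; monoidal
      _ = _ := by rw [whisker_exchange]; monoidal)

/-- The class functions `CF(D) = Hom(A, 𝟙)`. -/
abbrev CF : Type v := A D ⟶ 𝟙_ C

/-- The central elements `CE(D) = Hom(𝟙, A)`. -/
abbrev CE : Type v := 𝟙_ C ⟶ A D

variable {D}

/-- The product of class functions, `f ⋆ g = f ∘ Z(g) ∘ δ_𝟙`. -/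
noncomputable def CF.star (f g : CF D) : CF D := Z.comul D (𝟙_ C) ≫ Z.map D g ≫ f

/-- The natural endomorphism `ψ(a)` of the identity functor given by a central element `a`,
at `X`: `X = 𝟙 ⊗ X ⟶ A ⊗ X ⟶ X ⊗ X* ⊗ X ⟶ X`. -/
noncomputable def CE.ψ (a : CE D) (X : C) (hX : D.carrier X) : X ⟶ X :=
  (λ_ X).inv ≫ (a ≫ Z.π D (𝟙_ C) X hX) ▷ X ⊗≫ X ◁ ε_ X Xᘁ ≫ (ρ_ X).hom

theorem CE.ψ_naturality (a : CE D) {X Y : C} (hX : D.carrier X) (hY : D.carrier Y) (f : X ⟶ Y) :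
    CE.ψ a X hX ≫ f = f ≫ CE.ψ a Y hY := by
  have hc := Z.condition (V := 𝟙_ C) hX hY f
  have he := rightAdjointMate_comp_evaluation f
  simp only [CE.ψ]
  generalize Z.π D (𝟙_ C) X hX = P at *
  generalize Z.π D (𝟙_ C) Y hY = Q at *
  calc
    _ = (λ_ X).inv ≫ (a ≫ P) ▷ X ⊗≫ (X ◁ ε_ X Xᘁ ≫ f ▷ 𝟙_ C) ⊗≫ 𝟙 _ := by monoidal
    _ = (λ_ X).inv ≫ (a ≫ P ≫ f ▷ (𝟙_ C ⊗ Xᘁ)) ▷ X ⊗≫ Y ◁ ε_ X Xᘁ ⊗≫ 𝟙 _ := by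
      rw [whisker_exchange]; monoidal
    _ = (λ_ X).inv ≫ (a ≫ Q) ▷ X ⊗≫ Y ◁ (fᘁ ▷ X ≫ ε_ X Xᘁ) ⊗≫ 𝟙 _ := by
      rw [hc]; monoidal
    _ = (λ_ X).inv ≫ ((a ≫ Q) ▷ X ≫ (Y ⊗ (𝟙_ C ⊗ Yᘁ)) ◁ f) ⊗≫ Y ◁ ε_ Y Yᘁ ⊗≫ 𝟙 _ := by
      rw [he]; monoidal
    _ = _ := by rw [← whisker_exchange]; monoidal

/-- The natural endomorphism `ψ(a)^!` of the identity functor, `ψ(a)^!_X = (ψ(a)_{*X})^*`, where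
`(*X)^* = X`. -/
noncomputable def CE.ψDual (a : CE D) (X : C) (hX : D.carrier X) : X ⟶ X :=
  rightAdjointMate (X := HasLeftDual.leftDual X) (Y := HasLeftDual.leftDual X)
    (CE.ψ a (HasLeftDual.leftDual X) (D.leftDual hX))

theorem CE.ψDual_naturality (a : CE D) {X Y : C} (hX : D.carrier X) (hY : D.carrier Y)
    (f : X ⟶ Y) : CE.ψDual a X hX ≫ f = f ≫ CE.ψDual a Y hY := by
  have h := CE.ψ_naturality a (D.leftDual hY) (D.leftDual hX) (leftAdjointMate f)
  have hf : rightAdjointMate (leftAdjointMate f) = f := by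
    have e1 := coevaluation_comp_rightAdjointMate (leftAdjointMate f)
    have e2 := e1.trans (coevaluation_comp_leftAdjointMate f)
    have e3 := congrArg (tensorLeftHomEquiv _ (HasLeftDual.leftDual X) X _).symm e2
    erw [tensorLeftHomEquiv_symm_coevaluation_comp_whiskerLeft,
      tensorLeftHomEquiv_symm_coevaluation_comp_whiskerLeft] at e3
    exact (cancel_epi _).1 e3
  have h' := congrArg rightAdjointMate h
  rw [comp_rightAdjointMate, comp_rightAdjointMate, hf] at h'
  exact h'.symm

/-- The antipodal operator of `CE(D)`: `S(a)` is the central element with `ψ(S(a)) = ψ(a)^!`, that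
is `π_X ∘ S(a) = (ψ(a)^!_X ⊗ id_{X*}) ∘ coev_X`. -/
noncomputable def CE.antipode (a : CE D) : CE D :=
  Z.lift (fun X hX => η_ X Xᘁ ≫ CE.ψDual a X hX ▷ Xᘁ ≫ X ◁ (λ_ Xᘁ).inv) (by
    intro X Y hX hY f
    have h := coevaluation_comp_rightAdjointMate f
    have hn := CE.ψDual_naturality a hX hY f
    calc
      _ = η_ X Xᘁ ≫ (CE.ψDual a X hX ≫ f) ▷ Xᘁ ⊗≫ 𝟙 _ := by
        rw [Category.assoc, Category.assoc, whisker_exchange]; monoidal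
      _ = (η_ Y Yᘁ ≫ Y ◁ fᘁ) ≫ CE.ψDual a Y hY ▷ Xᘁ ⊗≫ 𝟙 _ := by rw [hn, h]; monoidal
      _ = η_ Y Yᘁ ≫ (Y ◁ fᘁ ≫ CE.ψDual a Y hY ▷ Xᘁ) ⊗≫ 𝟙 _ := by monoidal
      _ = _ := by rw [whisker_exchange]; monoidal)

theorem CE.ψ_antipode (a : CE D) (X : C) (hX : D.carrier X) :
    CE.ψ (CE.antipode a) X hX = CE.ψDual a X hX := by
  rw [CE.ψ, CE.antipode, Z.lift_π]
  calc
    _ = 𝟙 _ ⊗≫ η_ X Xᘁ ▷ X ⊗≫ (CE.ψDual a X hX ▷ (Xᘁ ⊗ X) ≫ X ◁ ε_ X Xᘁ) ⊗≫ 𝟙 _ := by monoidal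
    _ = 𝟙 _ ⊗≫ (η_ X Xᘁ ▷ X ⊗≫ X ◁ ε_ X Xᘁ) ⊗≫ CE.ψDual a X hX ⊗≫ 𝟙 _ := by
      rw [← whisker_exchange]; monoidal
    _ = _ := by rw [ExactPairing.evaluation_coevaluation'']; monoidal

/-- The right action of central elements on class functions, `f ↼ b = f ∘ m ∘ (b ⊗ id_A)`. -/
noncomputable def CF.act (f : CF D) (b : CE D) : CF D :=
  (λ_ (A D)).inv ≫ b ▷ A D ≫ mulA D ≫ f

/-- The Fourier transform `CE(D) ⟶ CF(D)`, `a ↦ t ↼ S(a)`, associated to a class function `t`. -/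
noncomputable def fourier (t : CF D) (a : CE D) : CF D := t.act a.antipode

/-- Cointegrals: class functions `t` with `Z(t) ∘ δ_𝟙 = u ∘ t`. -/
def IsCointegral (t : CF D) : Prop := Z.comul D (𝟙_ C) ≫ Z.map D t = t ≫ unitA D

/-- The idempotent cointegral: the cointegral `t` normalised by `⟨t, u⟩ = 1`. -/
def IsIdempotentCointegral (t : CF D) : Prop := IsCointegral t ∧ unitA D ≫ t = 𝟙 (𝟙_ C)

variable (D) in
/-- The idempotent cointegral of `D`, as a class function of `D`. -/
noncomputable def cointegral : CF D := Classical.epsilon IsIdempotentCointegral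

/-- A cointegral normalised by `⟨t, u⟩ = 1` is indeed idempotent. -/
theorem IsIdempotentCointegral.star_self {t : CF D} (h : IsIdempotentCointegral t) :
    CF.star t t = t := by
  have h1 : Z.comul D (𝟙_ C) ≫ Z.map D t = t ≫ unitA D := h.1
  rw [CF.star, ← Category.assoc, h1, Category.assoc, h.2, Category.comp_id]

variable (D) in
/-- The canonical map `q : A_C ⟶ A_D`, determined by `π_X ∘ q = π_X` for `X ∈ D`. -/
noncomputable def restrictA : A (FusionSubcategory.top C) ⟶ A D :=
  Z.lift (fun X _ => Z.π (FusionSubcategory.top C) (𝟙_ C) X trivial)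
    (fun _ _ _ _ f => Z.condition (D := FusionSubcategory.top C) trivial trivial f)

variable (D) in
/-- `λ_D`, the idempotent cointegral of `D` viewed in `CF(C)` along `CF(D) ↪ CF(C)`, `t ↦ t ∘ q`. -/
noncomputable def lam : CF (FusionSubcategory.top C) := restrictA D ≫ cointegral D

end Adjoint

section Idempotents

variable (C : Type u) [Category.{v} C] [Abelian C] [Linear ℂ C] [MonoidalCategory C]
  [MonoidalPreadditive C] [MonoidalLinear ℂ C] [RigidCategory C] [IsFusionCategory C]

variable {C} in
/-- Central idempotents of `CF(C)`. -/
def IsCentralIdempotent (e : CF (FusionSubcategory.top C)) : Prop :=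
  CF.star e e = e ∧ ∀ f, CF.star e f = CF.star f e

/-- The primitive central idempotents `F_j` of `CF(C)`: the nonzero central idempotents `e` such
that every central idempotent `f` with `e ⋆ f = f` is `0` or `e`. -/
def PrimIdem : Type v :=
  {e : CF (FusionSubcategory.top C) // IsCentralIdempotent e ∧ e ≠ 0 ∧
    ∀ f, IsCentralIdempotent f → CF.star e f = f → f = 0 ∨ f = e}

variable {C}

/-- The class function `F_j`. -/
def PrimIdem.F (j : PrimIdem C) : CF (FusionSubcategory.top C) := j.1

noncomputable instance : DecidableEq (PrimIdem C) := Classical.decEq _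

/-- The set `L_D` of indices, determined by `λ_D = ∑_{j ∈ L_D} F_j`. -/
noncomputable def indexSet (D : FusionSubcategory C) : Finset (PrimIdem C) :=
  Classical.epsilon fun L => lam D = ∑ j ∈ L, j.F

variable (C) in
/-- The Fourier transform `F_λ : CE(C) ⟶ CF(C)` associated to the cointegral `λ` of `C` with
`⟨λ, u⟩ = 1`. -/
noncomputable def fourierTransform :
    CE (FusionSubcategory.top C) → CF (FusionSubcategory.top C) :=
  fourier (cointegral (FusionSubcategory.top C))

/-- The inverse Fourier transform. -/
noncomputable def fourierInv (h : Function.Bijective (fourierTransform C)) :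
    CF (FusionSubcategory.top C) → CE (FusionSubcategory.top C) :=
  (Equiv.ofBijective _ h).symm

/-- The conjugacy class sum attached to `F_j`, the inverse Fourier transform of `F_j`. -/
noncomputable def classSum (h : Function.Bijective (fourierTransform C)) (j : PrimIdem C) :
    CE (FusionSubcategory.top C) := fourierInv h j.F

/-- The central element `ℓ_D`, the inverse Fourier transform of `λ_D`. -/
noncomputable def ell (h : Function.Bijective (fourierTransform C)) (D : FusionSubcategory C) :
    CE (FusionSubcategory.top C) := fourierInv h (lam D)

end Idempotents

section PseudoUnitary

variable (C : Type u) [Category.{v} C] [Abelian C] [Linear ℂ C] [MonoidalCategory C]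
  [MonoidalPreadditive C] [MonoidalLinear ℂ C] [RigidCategory C]

/-- A pivotal structure: an isomorphism `id ⟶ ()**` of monoidal functors.
(Compatibility with the unit follows from compatibility with tensor products, since all the
components are isomorphisms.) -/
structure PivotalStructure where
  iso (X : C) : X ≅ (Xᘁ)ᘁ
  naturality {X Y : C} (f : X ⟶ Y) : f ≫ (iso Y).hom = (iso X).hom ≫ (fᘁ)ᘁ
  tensor (X Y : C) : (iso (X ⊗ Y)).hom ≫ ((rightDualTensorIso X Y).inv)ᘁ =
    ((iso X).hom ⊗ₘ (iso Y).hom) ≫ (rightDualTensorIso (Yᘁ) (Xᘁ)).inv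

variable {C}

/-- The pivotal dimension of an object, as an endomorphism of the unit object. -/
def PivotalStructure.dim (a : PivotalStructure C) (X : C) : 𝟙_ C ⟶ 𝟙_ C :=
  η_ X Xᘁ ≫ (a.iso X).hom ▷ Xᘁ ≫ ε_ (Xᘁ) (Xᘁ)ᘁ

/-- The global dimension `∑ dim(V) dim(V*)`, summed over the isomorphism classes of simple
objects, as an endomorphism of the unit object. -/
noncomputable def PivotalStructure.globalDim (a : PivotalStructure C) : 𝟙_ C ⟶ 𝟙_ C :=
  ∑ᶠ i : Irr C, a.dim i.rep ≫ a.dim (i.repᘁ)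

variable (R : Type*) [CommRing R]

variable (C) in
/-- The Grothendieck ring with coefficients in `R`: free on the isomorphism classes of simple
objects. -/
abbrev Gr : Type _ := Irr C →₀ R

/-- The class `∑_k [X : V_k] [V_k]` of an object `X`, where `[X : V_k] = dim Hom(V_k, X)`. -/
noncomputable def Gr.cls [IsFusionCategory C] (X : C) : Gr C R :=
  Finsupp.equivFunOnFinite.symm fun k => (Module.finrank ℂ (k.rep ⟶ X) : R)

/-- The multiplication of the Grothendieck ring: the bilinear map with
`[V_i] [V_j] = [V_i ⊗ V_j]`. -/
noncomputable def Gr.mul [IsFusionCategory C] : Gr C R →ₗ[R] Gr C R →ₗ[R] Gr C R :=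
  Finsupp.lift _ R (Irr C) fun i =>
    Finsupp.linearCombination R fun j => Gr.cls R (i.rep ⊗ j.rep)

theorem Gr.mul_single [IsFusionCategory C] (i j : Irr C) :
    Gr.mul R (Finsupp.single i 1) (Finsupp.single j 1) = Gr.cls R (i.rep ⊗ j.rep) := by
  simp [Gr.mul]

/-- The Frobenius-Perron dimension of an object `X`: the largest absolute value of an eigenvalue
of multiplication by `[X]` on the complexified Grothendieck ring. -/
noncomputable def FPdim [IsFusionCategory C] (X : C) : ℝ :=
  (spectralRadius ℂ (Gr.mul ℂ (Gr.cls ℂ X) : Module.End ℂ (Gr C ℂ))).toReal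

variable (C) in
/-- The Frobenius-Perron dimension of `C`. -/
noncomputable def globalFPdim [IsFusionCategory C] : ℝ :=
  ∑ᶠ i : Irr C, FPdim i.rep ^ 2

/-- `C` is pseudo-unitary: `FPdim(C) = dim(C)`. -/
def PivotalStructure.IsPseudoUnitary [IsFusionCategory C] (a : PivotalStructure C) : Prop :=
  a.globalDim = (globalFPdim C : ℂ) • 𝟙 (𝟙_ C)

end PseudoUnitary

end FusionCat

open FusionCat

set_option linter.unusedSectionVars false

/-! The pivotal structure attaches to each object `X` of a fusion subcategory `K` a class function
`χ_X`, the projection `π_X` followed by the pivotal evaluation. These satisfy `χ_X ⋆ χ_Y = χ_{X ⊗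
Y}` (`chi_star_chi`), depend only on multiplicities, and for simple objects form a basis
(`linearIndependent_chi`, `finrank_CF`). Thus `CF(K)` is the complexified Grothendieck ring of `K`,
and it is commutative (`star_comm`).

Existence of the cointegral is a handle-slide argument: `R = ∑ dim(V_i) χ_i` is a cointegral
(`coact_regular`), so `f ⋆ R = ⟨f, u⟩ R`. If `⟨R, u⟩` were zero, then `R ⋆ R = 0`. But
multiplication by `χ_X` is adjoint to multiplication by `χ_{X*}` for the hermitian form with the
`χ_i` orthonormal, so the algebra has no nonzero elements of square zero (`eq_zero_of_star_self`).
Hence `R` can be normalised, and commutativity makes the result unique.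

For the join, say that `t` absorbs `X` when coacting by `t` at `X` gives `t` followed by the
coevaluation (`Absorbs`). The absorbed objects are closed under tensor products, direct sums and
retracts; `λ_K` absorbs the objects of `K`; and `λ_K ⋆ t = t` whenever `t` absorbs `K` (`lam_star`).
The product `λ_D ⋆ λ_E` absorbs `D` and `E`, hence `D ∨ E`, so `λ_{D ∨ E}` fixes it. Conversely
`λ_D` and `λ_E` both fix `λ_{D ∨ E}`. Commutativity gives `λ_{D ∨ E} = λ_D ⋆ λ_E` (`lam_join`).

The rest is commutative algebra: idempotents are unique sums of primitive ones, and multiplying them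
intersects index sets. The Fourier transform is linear, and bijective because all `χ_i`-coordinates
of `λ` are nonzero. -/

namespace FusionCat

/-! ### Evaluations, coevaluations and traces of a pivotal structure. -/

section Pivotal

variable {C : Type u} [Category.{v} C] [Abelian C] [Linear ℂ C] [MonoidalCategory C]
  [MonoidalPreadditive C] [MonoidalLinear ℂ C] [RigidCategory C]

namespace PivotalStructure

variable (a : PivotalStructure C)

/-- The pairing of `X*` with `X` given by the pivotal structure. -/
@[reducible]
def pairing (X : C) : ExactPairing (Xᘁ) X := exactPairingCongrRight (a.iso X)

/-- The evaluation `X ⊗ X* ⟶ 𝟙` given by the pivotal structure. -/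
def ev (X : C) : X ⊗ Xᘁ ⟶ 𝟙_ C := (a.iso X).hom ▷ Xᘁ ≫ ε_ (Xᘁ) (Xᘁ)ᘁ

/-- The coevaluation `𝟙 ⟶ X* ⊗ X` given by the pivotal structure. -/
def coev (X : C) : 𝟙_ C ⟶ Xᘁ ⊗ X := η_ (Xᘁ) (Xᘁ)ᘁ ≫ Xᘁ ◁ (a.iso X).inv

theorem coev_ev_right (X : C) : X ◁ a.coev X ⊗≫ a.ev X ▷ X = ⊗𝟙.hom :=
  @ExactPairing.coevaluation_evaluation'' C _ _ (Xᘁ) X (a.pairing X)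

theorem coev_ev_left (X : C) : a.coev X ▷ Xᘁ ⊗≫ Xᘁ ◁ a.ev X = ⊗𝟙.hom :=
  @ExactPairing.evaluation_coevaluation'' C _ _ (Xᘁ) X (a.pairing X)

theorem ev_naturality {X Y : C} (f : X ⟶ Y) : f ▷ Yᘁ ≫ a.ev Y = X ◁ fᘁ ≫ a.ev X := by
  rw [ev, ← comp_whiskerRight_assoc, a.naturality, comp_whiskerRight, Category.assoc,
    rightAdjointMate_comp_evaluation, ← whisker_exchange_assoc, ev]

theorem iso_inv_naturality {X Y : C} (f : X ⟶ Y) :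
    (a.iso X).inv ≫ f = (fᘁ)ᘁ ≫ (a.iso Y).inv := by
  rw [Iso.inv_comp_eq, ← Category.assoc, ← a.naturality, Category.assoc, Iso.hom_inv_id,
    Category.comp_id]

theorem coev_naturality {X Y : C} (f : X ⟶ Y) : a.coev X ≫ Xᘁ ◁ f = a.coev Y ≫ fᘁ ▷ Y := by
  rw [coev, Category.assoc, ← MonoidalCategory.whiskerLeft_comp, iso_inv_naturality,
    MonoidalCategory.whiskerLeft_comp, coevaluation_comp_rightAdjointMate_assoc,
    ← whisker_exchange, coev, Category.assoc]

theorem rightDualTensorIso_inv_evaluation (X Y : C) :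
    (rightDualTensorIso X Y).inv ▷ (X ⊗ Y) ≫ ε_ (X ⊗ Y) (X ⊗ Y)ᘁ = ε_ (X ⊗ Y) (Yᘁ ⊗ Xᘁ) := by
  rw [← rightDualTensorIso_hom_evaluation, ← comp_whiskerRight_assoc]
  simp

theorem coevaluation_rightDualTensorIso (X Y : C) :
    η_ (X ⊗ Y) (X ⊗ Y)ᘁ ≫ (X ⊗ Y) ◁ (rightDualTensorIso X Y).hom = η_ (X ⊗ Y) (Yᘁ ⊗ Xᘁ) := by
  have := @coevaluation_comp_rightAdjointMate C _ _ (X ⊗ Y) (X ⊗ Y) ⟨Yᘁ ⊗ Xᘁ⟩ _ (𝟙 (X ⊗ Y))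
  rw [id_whiskerRight, Category.comp_id] at this
  exact this

/-- The monoidality axiom of the pivotal structure enters here: it makes nested evaluations an
evaluation of the tensor product, which later becomes multiplicativity of `chi`. -/
theorem ev_tensor (X Y : C) :
    (X ⊗ Y) ◁ (rightDualTensorIso X Y).hom ⊗≫ X ◁ (a.ev Y ▷ Xᘁ) ⊗≫ a.ev X = a.ev (X ⊗ Y) := by
  have h1 : 𝟙 ((X ⊗ Y) ⊗ (Yᘁ ⊗ Xᘁ)) ⊗≫ X ◁ (a.ev Y ▷ Xᘁ) ⊗≫ a.ev X =
      ((a.iso X).hom ⊗ₘ (a.iso Y).hom) ▷ (Yᘁ ⊗ Xᘁ) ≫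
        ε_ (Yᘁ ⊗ Xᘁ) ((Xᘁ)ᘁ ⊗ (Yᘁ)ᘁ) := by
    rw [ExactPairing.tensor_evaluation, MonoidalCategory.tensorHom_def, ev, ev]
    calc
      _ = 𝟙 _ ⊗≫ (X ◁ (((a.iso Y).hom ▷ Yᘁ ≫ ε_ (Yᘁ) (Yᘁ)ᘁ) ▷ Xᘁ) ≫
           (a.iso X).hom ▷ (𝟙_ C ⊗ Xᘁ)) ⊗≫ ε_ (Xᘁ) (Xᘁ)ᘁ := by monoidal
      _ = _ := by rw [whisker_exchange]; monoidal
  have h2 : ((a.iso X).hom ⊗ₘ (a.iso Y).hom) ▷ (Yᘁ ⊗ Xᘁ) ≫ ε_ (Yᘁ ⊗ Xᘁ) ((Xᘁ)ᘁ ⊗ (Yᘁ)ᘁ) =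
      (X ⊗ Y) ◁ (rightDualTensorIso X Y).inv ≫ a.ev (X ⊗ Y) := by
    rw [← rightDualTensorIso_inv_evaluation, ← comp_whiskerRight_assoc, ← a.tensor,
      comp_whiskerRight, Category.assoc, rightAdjointMate_comp_evaluation, ev,
      whisker_exchange_assoc]
  calc
    _ = (X ⊗ Y) ◁ (rightDualTensorIso X Y).hom ≫
        (𝟙 ((X ⊗ Y) ⊗ (Yᘁ ⊗ Xᘁ)) ⊗≫ X ◁ (a.ev Y ▷ Xᘁ) ⊗≫ a.ev X) := by monoidal
    _ = _ := by
      rw [h1, h2, ← MonoidalCategory.whiskerLeft_comp_assoc]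
      simp

/-- Coevaluations are determined by the evaluations. -/
theorem coev_unique {X X' : C} {e : X ⊗ X' ⟶ 𝟙_ C} {c c' : 𝟙_ C ⟶ X' ⊗ X}
    (h : X ◁ c ⊗≫ e ▷ X = ⊗𝟙.hom) (h' : c' ▷ X' ⊗≫ X' ◁ e = ⊗𝟙.hom) : c = c' := by
  calc
    c = c ⊗≫ (c' ▷ X' ⊗≫ X' ◁ e) ▷ X ⊗≫ 𝟙 _ := by rw [h']; monoidal
    _ = 𝟙 _ ⊗≫ (𝟙_ C ◁ c ≫ c' ▷ (X' ⊗ X)) ⊗≫ (X' ◁ e) ▷ X ⊗≫ 𝟙 _ := by monoidal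
    _ = c' ⊗≫ X' ◁ (X ◁ c ⊗≫ e ▷ X) ⊗≫ 𝟙 _ := by rw [whisker_exchange]; monoidal
    _ = c' := by rw [h]; monoidal

/-- Both sides are coevaluations for the same nested evaluation, one by each zigzag identity, so
`coev_unique` identifies them. -/
theorem coev_tensor (X Y : C) :
    a.coev (X ⊗ Y) ≫ (rightDualTensorIso X Y).hom ▷ (X ⊗ Y) =
      a.coev Y ⊗≫ Yᘁ ◁ (a.coev X ▷ Y) ⊗≫ 𝟙 _ := by
  symm
  apply coev_unique (e := 𝟙 ((X ⊗ Y) ⊗ (Yᘁ ⊗ Xᘁ)) ⊗≫ X ◁ (a.ev Y ▷ Xᘁ) ⊗≫ a.ev X)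
  · calc
      _ = 𝟙 ((X ⊗ Y) ⊗ 𝟙_ C) ⊗≫ X ◁ (Y ◁ a.coev Y) ⊗≫ X ◁ ((Y ⊗ Yᘁ) ◁ (a.coev X ▷ Y) ≫
            a.ev Y ▷ ((Xᘁ ⊗ X) ⊗ Y)) ⊗≫ a.ev X ▷ (X ⊗ Y) := by monoidal
      _ = 𝟙 ((X ⊗ Y) ⊗ 𝟙_ C) ⊗≫ X ◁ (Y ◁ a.coev Y ⊗≫ a.ev Y ▷ Y) ⊗≫
          (X ◁ a.coev X ⊗≫ a.ev X ▷ X) ▷ Y ⊗≫ 𝟙 _ := by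
        rw [whisker_exchange]; monoidal
      _ = _ := by rw [coev_ev_right, coev_ev_right]; monoidal
  -- The nested evaluation is `a.ev (X ⊗ Y)` transported to the other model of the dual, so the
  -- second zigzag reduces to the one for `X ⊗ Y`.
  · have key : (X ⊗ Y) ◁ (rightDualTensorIso X Y).inv ≫ a.ev (X ⊗ Y) =
        𝟙 ((X ⊗ Y) ⊗ (Yᘁ ⊗ Xᘁ)) ⊗≫ X ◁ (a.ev Y ▷ Xᘁ) ⊗≫ a.ev X := by
      rw [← ev_tensor]
      calc
        _ = (X ⊗ Y) ◁ ((rightDualTensorIso X Y).inv ≫ (rightDualTensorIso X Y).hom) ⊗≫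
              X ◁ (a.ev Y ▷ Xᘁ) ⊗≫ a.ev X := by monoidal
        _ = _ := by rw [Iso.inv_hom_id]; monoidal
    rw [← key]
    calc
      _ = a.coev (X ⊗ Y) ▷ (Yᘁ ⊗ Xᘁ) ⊗≫
          ((rightDualTensorIso X Y).hom ▷ ((X ⊗ Y) ⊗ (Yᘁ ⊗ Xᘁ)) ≫
          (Yᘁ ⊗ Xᘁ) ◁ ((X ⊗ Y) ◁ (rightDualTensorIso X Y).inv ≫ a.ev (X ⊗ Y))) := by monoidal
      _ = (a.coev (X ⊗ Y) ▷ (Yᘁ ⊗ Xᘁ) ≫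
          ((X ⊗ Y)ᘁ ⊗ (X ⊗ Y)) ◁ (rightDualTensorIso X Y).inv) ⊗≫
          (X ⊗ Y)ᘁ ◁ a.ev (X ⊗ Y) ⊗≫ (rightDualTensorIso X Y).hom ⊗≫ 𝟙 _ := by
        rw [← whisker_exchange]; monoidal
      _ = 𝟙 _ ⊗≫ (rightDualTensorIso X Y).inv ⊗≫ (a.coev (X ⊗ Y) ▷ (X ⊗ Y)ᘁ ⊗≫
          (X ⊗ Y)ᘁ ◁ a.ev (X ⊗ Y)) ⊗≫ (rightDualTensorIso X Y).hom ⊗≫ 𝟙 _ := by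
        rw [← whisker_exchange]; monoidal
      _ = 𝟙 _ ⊗≫ ((rightDualTensorIso X Y).inv ≫ (rightDualTensorIso X Y).hom) ⊗≫ 𝟙 _ := by
        rw [coev_ev_left]; monoidal
      _ = _ := by rw [Iso.inv_hom_id]; monoidal

/-- The left trace of an endomorphism. -/
def trL {X : C} (f : X ⟶ X) : 𝟙_ C ⟶ 𝟙_ C := a.coev X ≫ Xᘁ ◁ f ≫ ε_ X Xᘁ

/-- Slide `f` around the loop: through the coevaluation onto the dual strand, then back through the
evaluation. -/
theorem trL_comm {X Y : C} (f : X ⟶ Y) (g : Y ⟶ X) : a.trL (f ≫ g) = a.trL (g ≫ f) := by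
  rw [trL, MonoidalCategory.whiskerLeft_comp, Category.assoc, ← Category.assoc (a.coev X),
    coev_naturality, Category.assoc, ← whisker_exchange_assoc, rightAdjointMate_comp_evaluation,
    trL, MonoidalCategory.whiskerLeft_comp, Category.assoc]

/-- The left partial trace over `X` of an endomorphism of `X ⊗ Y`. -/
def ptrL (X : C) {Y : C} (f : X ⊗ Y ⟶ X ⊗ Y) : Y ⟶ Y :=
  𝟙 _ ⊗≫ a.coev X ▷ Y ⊗≫ Xᘁ ◁ f ⊗≫ ε_ X Xᘁ ▷ Y ⊗≫ 𝟙 _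

/-- A loop coloured by `X ⊗ Y` is a loop coloured by `X` inside one coloured by `Y`. -/
theorem trL_ptrL (X : C) {Y : C} (f : X ⊗ Y ⟶ X ⊗ Y) : a.trL (a.ptrL X f) = a.trL f := by
  have h : ε_ (X ⊗ Y) (X ⊗ Y)ᘁ = (rightDualTensorIso X Y).hom ▷ (X ⊗ Y) ≫
      (𝟙 _ ⊗≫ Yᘁ ◁ (ε_ X Xᘁ ▷ Y) ⊗≫ ε_ Y Yᘁ) := by
    rw [← rightDualTensorIso_hom_evaluation]; rfl
  symm
  calc
    _ = a.coev (X ⊗ Y) ≫ (rightDualTensorIso X Y).hom ▷ (X ⊗ Y) ≫ (Yᘁ ⊗ Xᘁ) ◁ f ⊗≫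
        Yᘁ ◁ (ε_ X Xᘁ ▷ Y) ⊗≫ ε_ Y Yᘁ := by
      rw [trL, h, whisker_exchange_assoc]; monoidal
    _ = _ := by
      rw [← Category.assoc, coev_tensor, trL, ptrL]; monoidal

end PivotalStructure

end Pivotal

attribute [instance] Irr.simple_rep

/-! ### Schur's lemma, dual bases of morphism spaces, and simplicity of the unit. -/

section Semisimple

variable {C : Type u} [Category.{v} C] [Abelian C] [Linear ℂ C] [MonoidalCategory C]
  [MonoidalPreadditive C] [MonoidalLinear ℂ C] [RigidCategory C] [IsFusionCategory C]

/-- The isomorphism classes of simple objects of a fusion subcategory. -/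
abbrev Idx (K : FusionSubcategory C) : Type _ := {i : Irr C // K.carrier i.rep}

noncomputable instance (K : FusionSubcategory C) : Fintype (Idx K) := Fintype.ofFinite _

noncomputable instance (K : FusionSubcategory C) : DecidableEq (Idx K) := Classical.decEq _

theorem FusionSubcategory.exists_sum_eq_id (K : FusionSubcategory C) {X : C} (hX : K.carrier X) :
    ∃ (n : ℕ) (a : Fin n → Idx K) (p : ∀ k, X ⟶ (a k).1.rep) (q : ∀ k, (a k).1.rep ⟶ X),
      ∑ k, p k ≫ q k = 𝟙 X := by
  obtain ⟨n, a, p, q, h⟩ := K.exists_decomposition ⟨X, hX⟩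
  refine ⟨n, a, fun k => (p k).hom, fun k => (q k).hom, ?_⟩
  have := congrArg K.carrier.ι.map h
  rw [Functor.map_sum] at this
  simpa using this

theorem FusionSubcategory.hom_ext_right (K : FusionSubcategory C) {X Y : C} (hX : K.carrier X)
    {f g : X ⟶ Y} (h : ∀ (i : Idx K) (q : i.1.rep ⟶ X), q ≫ f = q ≫ g) : f = g := by
  obtain ⟨n, a, p, q, hpq⟩ := K.exists_sum_eq_id hX
  rw [← Category.id_comp f, ← Category.id_comp g, ← hpq]
  simp only [Preadditive.sum_comp, Category.assoc, h]

theorem FusionSubcategory.hom_ext_left (K : FusionSubcategory C) {X Y : C} (hY : K.carrier Y)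
    {f g : X ⟶ Y} (h : ∀ (i : Idx K) (p : Y ⟶ i.1.rep), f ≫ p = g ≫ p) : f = g := by
  obtain ⟨n, a, p, q, hpq⟩ := K.exists_sum_eq_id hY
  rw [← Category.comp_id f, ← Category.comp_id g, ← hpq]
  simp only [Preadditive.comp_sum, ← Category.assoc, h]

/-- Morphisms into `X` are detected by morphisms from `X` to simple objects; a nonzero composite of
`q` with one of these is an isomorphism by Schur's lemma, which can be inverted. -/
theorem exists_retraction {S X : C} [Simple S] {q : S ⟶ X} (hq : q ≠ 0) :
    ∃ p : X ⟶ S, q ≫ p = 𝟙 S := by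
  by_contra! h
  refine hq ((FusionSubcategory.top C).hom_ext_left trivial fun i p => ?_)
  rw [zero_comp]
  by_contra h0
  have := isIso_of_hom_simple h0
  exact h (p ≫ inv (q ≫ p)) (by rw [← Category.assoc, IsIso.hom_inv_id])

theorem exists_section {S X : C} [Simple S] {p : X ⟶ S} (hp : p ≠ 0) :
    ∃ q : S ⟶ X, q ≫ p = 𝟙 S := by
  by_contra! h
  refine hp ((FusionSubcategory.top C).hom_ext_right trivial fun i q => ?_)
  rw [comp_zero]
  by_contra h0
  have := isIso_of_hom_simple h0
  exact h (inv (q ≫ p) ≫ q) (by rw [Category.assoc, IsIso.inv_hom_id])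

theorem id_simple_ne_zero (S : C) [Simple S] : 𝟙 S ≠ 0 := by
  intro h
  exact Simple.not_isZero S ((IsZero.iff_id_eq_zero S).2 h)

/-- Endomorphisms of a simple object are scalars. -/
noncomputable def scalar (S : C) [Simple S] : (S ⟶ S) ≃ₗ[ℂ] ℂ :=
  (LinearEquiv.ofBijective (LinearMap.toSpanSingleton ℂ (S ⟶ S) (𝟙 S)) ⟨by
    intro c d h
    simp only [LinearMap.toSpanSingleton_apply] at h
    exact smul_left_injective ℂ (id_simple_ne_zero S) h, fun f => by
    obtain ⟨c, hc⟩ := endomorphism_simple_eq_smul_id ℂ f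
    exact ⟨c, by simpa using hc⟩⟩).symm

theorem scalar_smul {S : C} [Simple S] (f : S ⟶ S) : scalar S f • 𝟙 S = f := by
  have := (scalar S).symm_apply_apply f
  exact this

@[simp]
theorem scalar_id (S : C) [Simple S] : scalar S (𝟙 S) = 1 := by
  have h := scalar_smul (𝟙 S)
  refine smul_left_injective ℂ (id_simple_ne_zero S) ?_
  simpa using h

/-- The composition pairing of `Hom(S, X)` with `Hom(X, S)`, for a simple object `S`. -/
noncomputable def compPairing (S X : C) [Simple S] : (S ⟶ X) →ₗ[ℂ] (X ⟶ S) →ₗ[ℂ] ℂ :=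
  LinearMap.mk₂ ℂ (fun q p => scalar S (q ≫ p)) (by simp) (by simp) (by simp) (by simp)

theorem compPairing_apply {S X : C} [Simple S] (q : S ⟶ X) (p : X ⟶ S) :
    compPairing S X q p = scalar S (q ≫ p) := rfl

theorem compPairing_injective (S X : C) [Simple S] : Function.Injective (compPairing S X) := by
  refine (injective_iff_map_eq_zero _).2 fun q hq => ?_
  by_contra h
  obtain ⟨p, hp⟩ := exists_retraction h
  have := LinearMap.congr_fun hq p
  rw [compPairing_apply, hp] at this
  simp at this

theorem compPairing_flip_injective (S X : C) [Simple S] :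
    Function.Injective (compPairing S X).flip := by
  refine (injective_iff_map_eq_zero _).2 fun p hp => ?_
  by_contra h
  obtain ⟨q, hq⟩ := exists_section h
  have := LinearMap.congr_fun hp q
  rw [LinearMap.flip_apply, compPairing_apply, hq] at this
  simp at this

theorem finrank_hom_comm (S X : C) [Simple S] :
    Module.finrank ℂ (S ⟶ X) = Module.finrank ℂ (X ⟶ S) := by
  apply le_antisymm
  · have := LinearMap.finrank_le_finrank_of_injective (compPairing_injective S X)
    rwa [Subspace.dual_finrank_eq] at this
  · have := LinearMap.finrank_le_finrank_of_injective (compPairing_flip_injective S X)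
    rwa [Subspace.dual_finrank_eq] at this

/-- The identification of `Hom(X, S)` with the dual space of `Hom(S, X)`. -/
noncomputable def homDualEquiv (S X : C) [Simple S] :
    (X ⟶ S) ≃ₗ[ℂ] Module.Dual ℂ (S ⟶ X) :=
  LinearEquiv.ofInjectiveOfFinrankEq (compPairing S X).flip (compPairing_flip_injective S X)
    (by rw [Subspace.dual_finrank_eq]; exact (finrank_hom_comm S X).symm)

/-- A basis of `Hom(S, X)`. -/
noncomputable def inB (S X : C) [Simple S] :
    Module.Basis (Fin (Module.finrank ℂ (S ⟶ X))) ℂ (S ⟶ X) :=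
  Module.finBasis ℂ (S ⟶ X)

/-- The basis of `Hom(X, S)` dual to `inB S X`. -/
noncomputable def outB (S X : C) [Simple S] :
    Module.Basis (Fin (Module.finrank ℂ (S ⟶ X))) ℂ (X ⟶ S) :=
  (inB S X).dualBasis.map (homDualEquiv S X).symm

theorem scalar_comp_outB {S X : C} [Simple S] (q : S ⟶ X) (α) :
    scalar S (q ≫ outB S X α) = (inB S X).repr q α := by
  have : homDualEquiv S X (outB S X α) q = (inB S X).repr q α := by
    simp [outB]
  exact this

theorem inB_outB {S X : C} [Simple S] (α β) :
    inB S X α ≫ outB S X β = if α = β then 𝟙 S else 0 := by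
  rw [← scalar_smul (inB S X α ≫ outB S X β), scalar_comp_outB]
  simp [Finsupp.single_apply]

theorem sum_scalar_inB {S X : C} [Simple S] (q : S ⟶ X) :
    ∑ α, scalar S (q ≫ outB S X α) • inB S X α = q := by
  simp only [scalar_comp_outB, Module.Basis.sum_repr]

theorem sum_scalar_outB {S X : C} [Simple S] (p : X ⟶ S) :
    ∑ α, scalar S (inB S X α ≫ p) • outB S X α = p := by
  have h : ∀ β, (outB S X).repr p β = scalar S (inB S X β ≫ p) := by
    intro β
    conv_rhs => rw [← (outB S X).sum_repr p]
    simp only [Preadditive.comp_sum, Linear.comp_smul, inB_outB, map_sum, map_smul, apply_ite,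
      scalar_id, map_zero]
    simp
  simp only [← h, Module.Basis.sum_repr]

theorem comp_eq_zero_of_ne {i j : Irr C} (h : i ≠ j) (f : i.rep ⟶ j.rep) : f = 0 :=
  (Irr.hom_eq f).resolve_right fun ⟨h', _⟩ => h h'

/-- The sum runs over the simple objects of `K` only: since `K` is closed under summands, these
suffice to test morphisms out of `X`. -/
theorem FusionSubcategory.sum_outB_inB (K : FusionSubcategory C) {X : C} (hX : K.carrier X) :
    ∑ i : Idx K, ∑ α, outB i.1.rep X α ≫ inB i.1.rep X α = 𝟙 X := by
  refine K.hom_ext_right hX fun j q => ?_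
  rw [Preadditive.comp_sum, Finset.sum_eq_single j]
  · rw [Category.comp_id, Preadditive.comp_sum]
    conv_rhs => rw [← sum_scalar_inB q]
    refine Finset.sum_congr rfl fun α _ => ?_
    rw [← Category.assoc, ← scalar_smul (q ≫ outB _ X α), Linear.smul_comp, Category.id_comp,
      scalar_smul]
  · intro i _ hij
    rw [Preadditive.comp_sum]
    refine Finset.sum_eq_zero fun α _ => ?_
    rw [← Category.assoc, comp_eq_zero_of_ne (fun h => hij (Subtype.ext h.symm)) (q ≫ outB _ X α),
      zero_comp]
  · simp

instance simple_unit : Simple (𝟙_ C) := by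
  obtain ⟨n, a, p, q, h⟩ := (FusionSubcategory.top C).exists_sum_eq_id (X := 𝟙_ C) trivial
  have hne : (𝟙 (𝟙_ C) : 𝟙_ C ⟶ 𝟙_ C) ≠ 0 := by
    intro h0
    have : Subsingleton (𝟙_ C ⟶ 𝟙_ C) := ⟨fun f g => by
      rw [← Category.id_comp f, ← Category.id_comp g, h0, zero_comp, zero_comp]⟩
    have h1 := IsFusionCategory.finrank_end_unit (C := C)
    rw [Module.finrank_zero_of_subsingleton] at h1
    exact zero_ne_one h1
  have hk : ∃ k, p k ≫ q k ≠ 0 := by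
    by_contra! h'
    rw [← h] at hne
    exact hne (Finset.sum_eq_zero fun k _ => h' k)
  obtain ⟨k, hk⟩ := hk
  have hp : p k ≠ 0 := fun h0 => hk (by rw [h0, zero_comp])
  obtain ⟨r, hr⟩ := exists_section hp
  -- `p k ≫ r` is a nonzero idempotent of the one-dimensional algebra `End(𝟙)`, hence the identity;
  -- so `𝟙` is isomorphic to its simple summand.
  have hrp : p k ≫ r = 𝟙 (𝟙_ C) := by
    obtain ⟨c, hc⟩ := (finrank_eq_one_iff_of_nonzero' _ hne).1
      IsFusionCategory.finrank_end_unit (p k ≫ r)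
    have h2 : (p k ≫ r) ≫ (p k ≫ r) = p k ≫ r := by
      rw [Category.assoc, ← Category.assoc r, hr, Category.id_comp]
    rw [← hc] at h2 ⊢
    rw [Linear.smul_comp, Linear.comp_smul, Category.id_comp, smul_smul] at h2
    have h3 := smul_left_injective ℂ hne h2
    have h4 : c ≠ 0 := by
      rintro rfl
      have : p k = 0 := by
        rw [← Category.comp_id (p k), ← hr, ← Category.assoc, ← hc]; simp
      exact hp this
    have : c = 1 := mul_right_cancel₀ h4 (by simpa using h3)
    rw [this, one_smul]
  exact Simple.of_iso (Y := (a k).1.rep) ⟨p k, r, hrp, hr⟩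

end Semisimple

/-! ### Simple objects have nonzero dimensions. -/

section Dimension

variable {C : Type u} [Category.{v} C] [Abelian C] [Linear ℂ C] [MonoidalCategory C]
  [MonoidalPreadditive C] [MonoidalLinear ℂ C] [RigidCategory C] [IsFusionCategory C]

namespace PivotalStructure

variable (a : PivotalStructure C)

/-- The left dimension of an object. -/
noncomputable def dimL (X : C) : ℂ := scalar (𝟙_ C) (a.trL (𝟙 X))

/-- The right dimension of an object. -/
noncomputable def dimR (X : C) : ℂ := scalar (𝟙_ C) (η_ X Xᘁ ≫ a.ev X)

theorem trL_smul {X : C} (c : ℂ) (f : X ⟶ X) : a.trL (c • f) = c • a.trL f := by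
  simp [trL]

theorem scalar_trL {V : C} [Simple V] (f : V ⟶ V) :
    scalar (𝟙_ C) (a.trL f) = scalar V f * a.dimL V := by
  conv_lhs => rw [← scalar_smul f, trL_smul, map_smul]
  rfl

theorem evaluation_ne_zero (V : C) [Simple V] : ε_ V Vᘁ ≠ 0 := by
  intro h
  refine id_simple_ne_zero V ?_
  calc
    𝟙 V = 𝟙 _ ⊗≫ (η_ V Vᘁ ▷ V ⊗≫ V ◁ ε_ V Vᘁ) ⊗≫ 𝟙 _ := by
      rw [ExactPairing.evaluation_coevaluation'']; monoidal
    _ = 0 := by rw [h]; simp [monoidalComp]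

theorem ev_ne_zero (V : C) [Simple V] : a.ev V ≠ 0 := by
  intro h
  refine id_simple_ne_zero V ?_
  calc
    𝟙 V = 𝟙 _ ⊗≫ (V ◁ a.coev V ⊗≫ a.ev V ▷ V) ⊗≫ 𝟙 _ := by
      rw [coev_ev_right]; monoidal
    _ = 0 := by rw [h]; simp [monoidalComp]

/-- The evaluation is a nonzero map onto the simple unit, so it splits. By rigidity the section is
the coevaluation followed by an endomorphism `g` of `V`, a scalar; that scalar times the dimension
is `1`. -/
theorem dimL_ne_zero (V : C) [Simple V] : a.dimL V ≠ 0 := by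
  obtain ⟨r, hr⟩ := exists_section (evaluation_ne_zero V)
  let g : V ⟶ V := 𝟙 _ ⊗≫ V ◁ r ⊗≫ a.ev V ▷ V ⊗≫ 𝟙 _
  have h : r = a.coev V ≫ Vᘁ ◁ g := by
    symm
    calc
      _ = 𝟙 _ ⊗≫ (a.coev V ▷ 𝟙_ C ≫ (Vᘁ ⊗ V) ◁ r) ⊗≫ Vᘁ ◁ a.ev V ▷ V ⊗≫ 𝟙 _ := by
        simp only [g]; monoidal
      _ = r ⊗≫ (a.coev V ▷ Vᘁ ⊗≫ Vᘁ ◁ a.ev V) ▷ V ⊗≫ 𝟙 _ := by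
        rw [← whisker_exchange]; monoidal
      _ = r := by rw [coev_ev_left]; monoidal
  have h2 : a.trL g = 𝟙 _ := by
    rw [trL, ← Category.assoc, ← h, hr]
  have h3 := congrArg (scalar (𝟙_ C)) h2
  rw [scalar_trL, scalar_id] at h3
  exact right_ne_zero_of_mul_eq_one h3

theorem dimR_ne_zero (V : C) [Simple V] : a.dimR V ≠ 0 := by
  obtain ⟨r, hr⟩ := exists_section (a.ev_ne_zero V)
  let g : V ⟶ V := 𝟙 _ ⊗≫ r ▷ V ⊗≫ V ◁ ε_ V Vᘁ ⊗≫ 𝟙 _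
  have h : r = η_ V Vᘁ ≫ g ▷ Vᘁ := by
    symm
    calc
      _ = 𝟙 _ ⊗≫ (𝟙_ C ◁ η_ V Vᘁ ≫ r ▷ (V ⊗ Vᘁ)) ⊗≫ V ◁ ε_ V Vᘁ ▷ Vᘁ ⊗≫ 𝟙 _ := by
        simp only [g]; monoidal
      _ = r ⊗≫ V ◁ (Vᘁ ◁ η_ V Vᘁ ⊗≫ ε_ V Vᘁ ▷ Vᘁ) ⊗≫ 𝟙 _ := by
        rw [whisker_exchange]; monoidal
      _ = r := by rw [ExactPairing.coevaluation_evaluation'']; monoidal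
  rw [← scalar_smul g] at h
  rw [h] at hr
  have h3 := congrArg (scalar (𝟙_ C)) hr
  simp only [MonoidalLinear.smul_whiskerRight, id_whiskerRight, Linear.comp_smul, Linear.smul_comp,
    Category.comp_id, map_smul, scalar_id] at h3
  exact right_ne_zero_of_mul_eq_one h3

end PivotalStructure

end Dimension

/-! ### Compatibility of duals with the associator. -/

section Assoc

variable {C : Type u} [Category.{v} C] [MonoidalCategory C] [RightRigidCategory C]

theorem whiskerLeft_rightDualTensorIso_evaluation (X Y W : C) :
    (Wᘁ ◁ (rightDualTensorIso X Y).hom) ▷ ((X ⊗ Y) ⊗ W) ≫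
      ε_ ((X ⊗ Y) ⊗ W) (Wᘁ ⊗ (Yᘁ ⊗ Xᘁ)) = ε_ ((X ⊗ Y) ⊗ W) (Wᘁ ⊗ (X ⊗ Y)ᘁ) := by
  rw [ExactPairing.tensor_evaluation (X₁ := X ⊗ Y) (Y₁ := Yᘁ ⊗ Xᘁ),
    ExactPairing.tensor_evaluation (X₁ := X ⊗ Y) (Y₁ := (X ⊗ Y)ᘁ),
    ← rightDualTensorIso_hom_evaluation]
  monoidal

theorem rightDualTensorIso_whiskerRight_evaluation (X Y W : C) :
    ((rightDualTensorIso Y W).hom ▷ Xᘁ) ▷ (X ⊗ (Y ⊗ W)) ≫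
      ε_ (X ⊗ (Y ⊗ W)) ((Wᘁ ⊗ Yᘁ) ⊗ Xᘁ) = ε_ (X ⊗ (Y ⊗ W)) ((Y ⊗ W)ᘁ ⊗ Xᘁ) := by
  rw [ExactPairing.tensor_evaluation (X₂ := Y ⊗ W) (Y₂ := Wᘁ ⊗ Yᘁ),
    ExactPairing.tensor_evaluation (X₂ := Y ⊗ W) (Y₂ := (Y ⊗ W)ᘁ),
    ← rightDualTensorIso_hom_evaluation]
  calc
    _ = 𝟙 _ ⊗≫ ((rightDualTensorIso Y W).hom ▷ ((Xᘁ ⊗ X) ⊗ (Y ⊗ W)) ≫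
      (Wᘁ ⊗ Yᘁ) ◁ (ε_ X Xᘁ ▷ (Y ⊗ W))) ⊗≫ ε_ (Y ⊗ W) (Wᘁ ⊗ Yᘁ) := by monoidal
    _ = _ := by rw [← whisker_exchange]; monoidal

theorem dual_associator (X Y W : C) :
    (α_ X Y W).homᘁ ≫ (rightDualTensorIso (X ⊗ Y) W).hom ≫ Wᘁ ◁ (rightDualTensorIso X Y).hom =
      (rightDualTensorIso X (Y ⊗ W)).hom ≫ (rightDualTensorIso Y W).hom ▷ Xᘁ ≫
        (α_ Wᘁ Yᘁ Xᘁ).hom := by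
  apply dual_ext (X := (X ⊗ Y) ⊗ W)
  have e : (α_ Wᘁ Yᘁ Xᘁ).hom ▷ ((X ⊗ Y) ⊗ W) ≫ ε_ ((X ⊗ Y) ⊗ W) (Wᘁ ⊗ (Yᘁ ⊗ Xᘁ)) =
      ((Wᘁ ⊗ Yᘁ) ⊗ Xᘁ) ◁ (α_ X Y W).hom ≫ ε_ (X ⊗ (Y ⊗ W)) ((Wᘁ ⊗ Yᘁ) ⊗ Xᘁ) := by
    simp only [ExactPairing.tensor_evaluation]
    monoidal
  simp only [comp_whiskerRight, Category.assoc]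
  rw [whiskerLeft_rightDualTensorIso_evaluation, rightDualTensorIso_hom_evaluation,
    rightAdjointMate_comp_evaluation, e, ← whisker_exchange_assoc,
    rightDualTensorIso_whiskerRight_evaluation, ← whisker_exchange_assoc,
    rightDualTensorIso_hom_evaluation]

end Assoc

/-! ### Naturality and coassociativity of the comultiplication. -/

section Comonad

variable {C : Type u} [Category.{v} C] [Abelian C] [Linear ℂ C] [MonoidalCategory C]
  [MonoidalPreadditive C] [MonoidalLinear ℂ C] [RigidCategory C] [IsFusionCategory C]
  (D : FusionSubcategory C)

namespace Z

theorem map_π {V V' : C} (g : V ⟶ V') (X : C) (hX : D.carrier X) :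
    map D g ≫ π D V' X hX = π D V X hX ≫ X ◁ (g ▷ Xᘁ) := lift_π _ _ _ _

theorem map_comp {V V' V'' : C} (g : V ⟶ V') (g' : V' ⟶ V'') :
    map D (g ≫ g') = map D g ≫ map D g' := by
  apply hom_ext
  intro X hX
  simp [map_π]
  simp [← Category.assoc, map_π]

theorem map_add {V V' : C} (g g' : V ⟶ V') : map D (g + g') = map D g + map D g' := by
  apply hom_ext
  intro X hX
  simp [map_π]

theorem map_smul {V V' : C} (c : ℂ) (g : V ⟶ V') : map D (c • g) = c • map D g := by
  apply hom_ext
  intro X hX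
  simp [map_π]

theorem comul_π_eq_πTensor (V X Y : C) (hX : D.carrier X) (hY : D.carrier Y) :
    comul D V ≫ π D (Z D V) X hX ≫ X ◁ (π D V Y hY ▷ Xᘁ) = πTensor D V X Y hX hY :=
  comul_π D V X Y hX hY

theorem comul_naturality {V V' : C} (g : V ⟶ V') :
    map D g ≫ comul D V' = comul D V ≫ map D (map D g) := by
  apply hom_ext
  intro X hX
  apply conj_hom_ext
  intro Y hY
  have e1 : (map D g ≫ comul D V') ≫ π D (Z D V') X hX ≫ X ◁ (π D V' Y hY ▷ Xᘁ) =
      πTensor D V X Y hX hY ≫ X ◁ ((Y ◁ (g ▷ Yᘁ)) ▷ Xᘁ) := by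
    rw [Category.assoc, comul_π_eq_πTensor]
    simp only [πTensor]
    rw [← Category.assoc, map_π]
    calc
      _ = π D V (X ⊗ Y) (D.tensor hX hY) ≫ (X ⊗ Y) ◁ (g ▷ (X ⊗ Y)ᘁ ≫
        V' ◁ (rightDualTensorIso X Y).hom) ⊗≫ 𝟙 _ := by monoidal
      _ = _ := by rw [← whisker_exchange]; monoidal
  have e2 : (comul D V ≫ map D (map D g)) ≫ π D (Z D V') X hX ≫ X ◁ (π D V' Y hY ▷ Xᘁ) =
      πTensor D V X Y hX hY ≫ X ◁ ((Y ◁ (g ▷ Yᘁ)) ▷ Xᘁ) := by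
    rw [Category.assoc, ← Category.assoc (map D (map D g)), map_π, ← comul_π_eq_πTensor]
    simp only [Category.assoc, ← MonoidalCategory.whiskerLeft_comp, ← comp_whiskerRight, map_π]
  rw [Category.assoc _ _ (X ◁ _), Category.assoc _ _ (X ◁ _), e1, e2]

theorem conj_conj_hom_ext {V X Y W : C} {f g : W ⟶ X ⊗ ((Y ⊗ (Z D V ⊗ Yᘁ)) ⊗ Xᘁ)}
    (h : ∀ (U : C) (hU : D.carrier U),
      f ≫ X ◁ ((Y ◁ (π D V U hU ▷ Yᘁ)) ▷ Xᘁ) = g ≫ X ◁ ((Y ◁ (π D V U hU ▷ Yᘁ)) ▷ Xᘁ)) :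
    f = g := by
  apply (conjEquiv X W _).symm.injective
  apply conj_hom_ext
  intro U hU
  rw [conjEquiv_symm_comp, conjEquiv_symm_comp, h U hU]

/-- Projected to `X`, `Y`, `W`, the two sides are the universal maps at `X ⊗ (Y ⊗ W)` and at `(X ⊗
Y) ⊗ W`. Dinaturality along the associator, with `dual_associator` on the dual strand, identifies
them. -/
theorem coassoc (V : C) : comul D V ≫ map D (comul D V) = comul D V ≫ comul D (Z D V) := by
  apply hom_ext
  intro X hX
  apply conj_hom_ext
  intro Y hY
  apply conj_conj_hom_ext
  intro W hW
  have hXY := D.tensor hX hY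
  have hYW := D.tensor hY hW
  have e1 : (((comul D V ≫ map D (comul D V)) ≫ π D (Z D (Z D V)) X hX) ≫
      X ◁ (π D (Z D V) Y hY ▷ Xᘁ)) ≫ X ◁ ((Y ◁ (π D V W hW ▷ Yᘁ)) ▷ Xᘁ) =
      πTensor D V X (Y ⊗ W) hX hYW ≫ X ◁ (((Y ⊗ W) ◁ (V ◁ (rightDualTensorIso Y W).hom) ⊗≫
        𝟙 (Y ⊗ ((W ⊗ (V ⊗ Wᘁ)) ⊗ Yᘁ))) ▷ Xᘁ) := by
    have h := comul_π_eq_πTensor D V Y W hY hW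
    simp only [πTensor] at h
    simp only [Category.assoc]
    rw [← Category.assoc (map D _), map_π, ← MonoidalCategory.whiskerLeft_comp,
      ← comp_whiskerRight, Category.assoc, ← MonoidalCategory.whiskerLeft_comp,
      ← comp_whiskerRight, h, comp_whiskerRight, MonoidalCategory.whiskerLeft_comp,
      ← comul_π_eq_πTensor]
    simp only [Category.assoc]
  have e2 : (((comul D V ≫ comul D (Z D V)) ≫ π D (Z D (Z D V)) X hX) ≫
      X ◁ (π D (Z D V) Y hY ▷ Xᘁ)) ≫ X ◁ ((Y ◁ (π D V W hW ▷ Yᘁ)) ▷ Xᘁ) =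
      πTensor D V (X ⊗ Y) W hXY hW ≫ (X ⊗ Y) ◁ ((W ⊗ (V ⊗ Wᘁ)) ◁
        (rightDualTensorIso X Y).hom) ⊗≫ 𝟙 _ := by
    simp only [Category.assoc]
    have h := comul_π_eq_πTensor D (Z D V) X Y hX hY
    have h' := congrArg (fun k => comul D V ≫ k ≫ X ◁ ((Y ◁ (π D V W hW ▷ Yᘁ)) ▷ Xᘁ)) h
    simp only [Category.assoc] at h'
    rw [h', ← comul_π_eq_πTensor D V (X ⊗ Y) W]
    simp only [πTensor]
    calc
      _ = comul D V ≫ π D (Z D V) (X ⊗ Y) hXY ≫ (X ⊗ Y) ◁ (Z D V ◁ (rightDualTensorIso X Y).hom ≫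
        π D V W hW ▷ (Yᘁ ⊗ Xᘁ)) ⊗≫ 𝟙 _ := by monoidal
      _ = _ := by rw [whisker_exchange]; monoidal
  rw [e1, e2]
  have hc := condition (V := V) (D.tensor hXY hW) (D.tensor hX hYW) (α_ X Y W).hom
  symm
  calc
    _ = (π D V ((X ⊗ Y) ⊗ W) (D.tensor hXY hW) ≫ (α_ X Y W).hom ▷ (V ⊗ ((X ⊗ Y) ⊗ W)ᘁ)) ⊗≫
        (X ⊗ (Y ⊗ W)) ◁ (V ◁ ((rightDualTensorIso (X ⊗ Y) W).hom ≫
          Wᘁ ◁ (rightDualTensorIso X Y).hom)) ⊗≫ 𝟙 _ := by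
      simp only [πTensor]
      monoidal
    _ = π D V (X ⊗ (Y ⊗ W)) (D.tensor hX hYW) ≫ (X ⊗ (Y ⊗ W)) ◁ (V ◁ ((α_ X Y W).homᘁ ≫
          (rightDualTensorIso (X ⊗ Y) W).hom ≫ Wᘁ ◁ (rightDualTensorIso X Y).hom)) ⊗≫ 𝟙 _ := by
      rw [hc]; monoidal
    _ = _ := by
      rw [dual_associator]
      simp only [πTensor]
      monoidal

end Z

end Comonad

/-! ### The algebra of class functions and the characters of objects. -/

section ClassFunctions

variable {C : Type u} [Category.{v} C] [Abelian C] [Linear ℂ C] [MonoidalCategory C]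
  [MonoidalPreadditive C] [MonoidalLinear ℂ C] [RigidCategory C] [IsFusionCategory C]

namespace CF

variable {K : FusionSubcategory C}

/-- The product of class functions as a bilinear map. -/
noncomputable def starₗ (K : FusionSubcategory C) : CF K →ₗ[ℂ] CF K →ₗ[ℂ] CF K :=
  LinearMap.mk₂ ℂ star
    (fun f f' g => by simp only [star, Preadditive.comp_add])
    (fun c f g => by simp only [star, Linear.comp_smul])
    (fun f g g' => by simp only [star, Z.map_add, Preadditive.add_comp, Preadditive.comp_add])
    (fun c f g => by simp only [star, Z.map_smul, Linear.smul_comp, Linear.comp_smul])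

theorem starₗ_apply (f g : CF K) : starₗ K f g = star f g := rfl

/-- The map `A ⟶ X ⊗ 𝟙 ⊗ X*` given by `δ` and a class function on the inner factor. -/
noncomputable def coact (t : CF K) (X : C) (hX : K.carrier X) : A K ⟶ X ⊗ (𝟙_ C ⊗ Xᘁ) :=
  Z.comul K (𝟙_ C) ≫ Z.π K (A K) X hX ≫ X ◁ (t ▷ Xᘁ)

theorem star_π_comp (t : CF K) {X : C} (hX : K.carrier X) (g : X ⊗ (𝟙_ C ⊗ Xᘁ) ⟶ 𝟙_ C) :
    star (Z.π K (𝟙_ C) X hX ≫ g) t = coact t X hX ≫ g := by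
  simp only [star, coact, Category.assoc]
  rw [← Category.assoc (Z.map K t), Z.map_π, Category.assoc]

theorem coact_π_comp {X Y : C} (hX : K.carrier X) (hY : K.carrier Y)
    (g : Y ⊗ (𝟙_ C ⊗ Yᘁ) ⟶ 𝟙_ C) :
    coact (Z.π K (𝟙_ C) Y hY ≫ g) X hX = Z.πTensor K (𝟙_ C) X Y hX hY ≫ X ◁ (g ▷ Xᘁ) := by
  rw [coact, comp_whiskerRight, MonoidalCategory.whiskerLeft_comp, ← Z.comul_π_eq_πTensor]
  simp only [Category.assoc]

theorem coact_sum {ι : Type*} (s : Finset ι) (t : ι → CF K) (X : C) (hX : K.carrier X) :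
    coact (∑ i ∈ s, t i) X hX = ∑ i ∈ s, coact (t i) X hX := by
  simp only [coact, sum_whiskerRight, whiskerLeft_sum, Preadditive.comp_sum]

theorem coact_smul (c : ℂ) (t : CF K) (X : C) (hX : K.carrier X) :
    coact (c • t) X hX = c • coact t X hX := by
  simp [coact]

theorem coact_star (f g : CF K) (X : C) (hX : K.carrier X) :
    coact (star f g) X hX = Z.comul K (𝟙_ C) ≫ Z.map K g ≫ coact f X hX := by
  calc
    _ = Z.comul K (𝟙_ C) ≫ (Z.π K (A K) X hX ≫ X ◁ (Z.comul K (𝟙_ C) ▷ Xᘁ)) ≫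
        X ◁ (Z.map K g ▷ Xᘁ) ≫ X ◁ (f ▷ Xᘁ) := by
      simp only [coact, star, comp_whiskerRight, MonoidalCategory.whiskerLeft_comp, Category.assoc]
    _ = (Z.comul K (𝟙_ C) ≫ Z.map K (Z.comul K (𝟙_ C))) ≫ (Z.π K _ X hX ≫
        X ◁ (Z.map K g ▷ Xᘁ)) ≫ X ◁ (f ▷ Xᘁ) := by
      rw [← Z.map_π]; simp only [Category.assoc]
    _ = Z.comul K (𝟙_ C) ≫ (Z.comul K (A K) ≫ Z.map K (Z.map K g)) ≫ Z.π K _ X hX ≫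
        X ◁ (f ▷ Xᘁ) := by
      rw [Z.coassoc, ← Z.map_π]; simp only [Category.assoc]
    _ = _ := by
      rw [← Z.comul_naturality]; simp only [coact, Category.assoc]

theorem star_assoc (f g h : CF K) : star (star f g) h = star f (star g h) := by
  calc
    _ = Z.comul K (𝟙_ C) ≫ (Z.map K h ≫ Z.comul K (𝟙_ C)) ≫ Z.map K g ≫ f := by
      simp only [star, Category.assoc]
    _ = (Z.comul K (𝟙_ C) ≫ Z.map K (Z.comul K (𝟙_ C))) ≫ Z.map K (Z.map K h) ≫
        Z.map K g ≫ f := by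
      rw [Z.comul_naturality, Z.coassoc]; simp only [Category.assoc]
    _ = _ := by
      simp only [star, Z.map_comp, Category.assoc]

/-- Coassociativity turns the coaction at a tensor product into an iterated coaction; this is what
makes absorption stable under tensor products. -/
theorem coact_tensor (t : CF K) {X Y : C} (hX : K.carrier X) (hY : K.carrier Y) :
    coact t (X ⊗ Y) (K.tensor hX hY) ≫
        (X ⊗ Y) ◁ (𝟙_ C ◁ (rightDualTensorIso X Y).hom) ⊗≫ 𝟙 (X ⊗ ((Y ⊗ (𝟙_ C ⊗ Yᘁ)) ⊗ Xᘁ)) =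
      Z.comul K (𝟙_ C) ≫ Z.π K (A K) X hX ≫ X ◁ (coact t Y hY ▷ Xᘁ) := by
  symm
  calc
    _ = Z.comul K (𝟙_ C) ≫ (Z.π K (A K) X hX ≫ X ◁ (Z.comul K (𝟙_ C) ▷ Xᘁ)) ≫
        X ◁ (Z.π K (A K) Y hY ▷ Xᘁ) ≫ X ◁ ((Y ◁ (t ▷ Yᘁ)) ▷ Xᘁ) := by
      simp only [coact, comp_whiskerRight, MonoidalCategory.whiskerLeft_comp, Category.assoc]
    _ = (Z.comul K (𝟙_ C) ≫ Z.map K (Z.comul K (𝟙_ C))) ≫ Z.π K _ X hX ≫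
        X ◁ (Z.π K (A K) Y hY ▷ Xᘁ) ≫ X ◁ ((Y ◁ (t ▷ Yᘁ)) ▷ Xᘁ) := by
      rw [← Z.map_π]; simp only [Category.assoc]
    _ = Z.comul K (𝟙_ C) ≫ Z.πTensor K (A K) X Y hX hY ≫ X ◁ ((Y ◁ (t ▷ Yᘁ)) ▷ Xᘁ) := by
      rw [Z.coassoc, ← Z.comul_π_eq_πTensor]; simp only [Category.assoc]
    _ = Z.comul K (𝟙_ C) ≫ Z.π K (A K) (X ⊗ Y) (K.tensor hX hY) ≫
        (X ⊗ Y) ◁ (A K ◁ (rightDualTensorIso X Y).hom ≫ t ▷ _) ⊗≫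
          𝟙 (X ⊗ ((Y ⊗ (𝟙_ C ⊗ Yᘁ)) ⊗ Xᘁ)) := by
      rw [Z.πTensor]; monoidal
    _ = _ := by
      rw [whisker_exchange, coact]; monoidal

end CF

namespace PivotalStructure

variable (a : PivotalStructure C)

/-- The evaluation `X ⊗ (𝟙 ⊗ X*) ⟶ 𝟙`. -/
def ev₀ (X : C) : X ⊗ (𝟙_ C ⊗ Xᘁ) ⟶ 𝟙_ C := X ◁ (λ_ Xᘁ).hom ≫ a.ev X

theorem ev₀_naturality {X Y : C} (f : X ⟶ Y) :
    f ▷ (𝟙_ C ⊗ Yᘁ) ≫ a.ev₀ Y = X ◁ (𝟙_ C ◁ fᘁ) ≫ a.ev₀ X := by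
  rw [ev₀, ← whisker_exchange_assoc, ev_naturality, ev₀, ← MonoidalCategory.whiskerLeft_comp_assoc,
    ← MonoidalCategory.whiskerLeft_comp_assoc, leftUnitor_naturality]

theorem ev₀_tensor (X Y : C) :
    (X ⊗ Y) ◁ (𝟙_ C ◁ (rightDualTensorIso X Y).hom) ⊗≫ X ◁ (a.ev₀ Y ▷ Xᘁ) ≫ a.ev₀ X =
      a.ev₀ (X ⊗ Y) := by
  rw [ev₀, ev₀, ev₀, ← ev_tensor]
  monoidal

/-- The class function `χ_X` of an object `X`. -/
noncomputable def chi (K : FusionSubcategory C) (X : C) (hX : K.carrier X) : CF K :=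
  Z.π K (𝟙_ C) X hX ≫ a.ev₀ X

variable {K : FusionSubcategory C}

theorem coact_chi {X Y : C} (hX : K.carrier X) (hY : K.carrier Y) :
    CF.coact (a.chi K Y hY) X hX = Z.πTensor K (𝟙_ C) X Y hX hY ≫ X ◁ (a.ev₀ Y ▷ Xᘁ) :=
  CF.coact_π_comp hX hY _

theorem chi_star_chi {X Y : C} (hX : K.carrier X) (hY : K.carrier Y) :
    CF.star (a.chi K X hX) (a.chi K Y hY) = a.chi K (X ⊗ Y) (K.tensor hX hY) := by
  rw [chi, CF.star_π_comp, coact_chi, chi, Z.πTensor, ← ev₀_tensor]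
  monoidal

theorem unitA_chi {X : C} (hX : K.carrier X) :
    unitA K ≫ a.chi K X hX = a.dimR X • 𝟙 (𝟙_ C) := by
  rw [chi, unitA, ← Category.assoc, Z.lift_π, ev₀, dimR, scalar_smul]
  simp

/-- Cyclicity of the character: dinaturality carries `p` to the dual strand, and naturality of the
evaluation brings `q` there too. -/
theorem π_section_ev₀ {X V : C} (hX : K.carrier X) (hV : K.carrier V) (p : X ⟶ V) (q : V ⟶ X) :
    Z.π K (𝟙_ C) X hX ≫ (p ≫ q) ▷ (𝟙_ C ⊗ Xᘁ) ≫ a.ev₀ X =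
      Z.π K (𝟙_ C) V hV ≫ V ◁ (𝟙_ C ◁ (q ≫ p)ᘁ) ≫ a.ev₀ V := by
  rw [comp_whiskerRight, Category.assoc, ← Category.assoc, Z.condition hX hV, ev₀_naturality,
    comp_rightAdjointMate]
  simp only [MonoidalCategory.whiskerLeft_comp, Category.assoc]

theorem chi_eq_sum {X : C} (hX : K.carrier X) :
    a.chi K X hX = ∑ i : Idx K, (Module.finrank ℂ (i.1.rep ⟶ X) : ℂ) • a.chi K i.1.rep i.2 := by
  have h : a.chi K X hX = Z.π K (𝟙_ C) X hX ≫ (𝟙 X) ▷ (𝟙_ C ⊗ Xᘁ) ≫ a.ev₀ X := by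
    rw [chi, id_whiskerRight, Category.id_comp]
  rw [h, ← K.sum_outB_inB hX]
  simp only [sum_whiskerRight, Preadditive.sum_comp, Preadditive.comp_sum]
  refine Finset.sum_congr rfl fun i _ => ?_
  have : ∀ α, Z.π K (𝟙_ C) X hX ≫ (outB i.1.rep X α ≫ inB i.1.rep X α) ▷ (𝟙_ C ⊗ Xᘁ) ≫
      a.ev₀ X = a.chi K i.1.rep i.2 := by
    intro α
    rw [a.π_section_ev₀ hX i.2, inB_outB, if_pos rfl, chi]
    simp
  simp only [this, Finset.sum_const, Finset.card_univ, Fintype.card_fin, Nat.cast_smul_eq_nsmul]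

theorem chi_congr {X Y : C} (hX : K.carrier X) (hY : K.carrier Y)
    (h : ∀ i : Idx K, Module.finrank ℂ (i.1.rep ⟶ X) = Module.finrank ℂ (i.1.rep ⟶ Y)) :
    a.chi K X hX = a.chi K Y hY := by
  rw [chi_eq_sum, chi_eq_sum]
  simp only [h]

theorem chi_iso {X Y : C} (hX : K.carrier X) (hY : K.carrier Y) (e : X ≅ Y) :
    a.chi K X hX = a.chi K Y hY := by
  have h := a.π_section_ev₀ hX hY e.hom e.inv
  simpa [chi] using h

end PivotalStructure

/-! ### The characters of the simple objects form a basis. -/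

section Basis

variable (K : FusionSubcategory C)

/-- The projection to an isotypic component, as a natural endomorphism of the identity. -/
noncomputable def isotypicProj (i : Irr C) (X : C) : X ⟶ X :=
  ∑ α, outB i.rep X α ≫ inB i.rep X α

theorem isotypicProj_comp_eq_zero {i j : Irr C} (h : i ≠ j) {X Y : C} (f : X ⟶ Y) :
    isotypicProj i X ≫ f ≫ isotypicProj j Y = 0 := by
  simp only [isotypicProj, Preadditive.sum_comp, Preadditive.comp_sum]
  refine Finset.sum_eq_zero fun β _ => Finset.sum_eq_zero fun α _ => ?_
  have := comp_eq_zero_of_ne h (inB i.rep X α ≫ f ≫ outB j.rep Y β)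
  have h2 : (outB i.rep X α ≫ inB i.rep X α) ≫ f ≫ outB j.rep Y β ≫ inB j.rep Y β =
      outB i.rep X α ≫ (inB i.rep X α ≫ f ≫ outB j.rep Y β) ≫ inB j.rep Y β := by
    simp only [Category.assoc]
  rw [h2, this, zero_comp, comp_zero]

theorem isotypicProj_naturality (i : Irr C) {X Y : C} (f : X ⟶ Y) :
    isotypicProj i X ≫ f = f ≫ isotypicProj i Y := by
  have hsum : ∀ W : C, ∑ j : Idx (FusionSubcategory.top C), isotypicProj j.1 W = 𝟙 W :=
    fun W => (FusionSubcategory.top C).sum_outB_inB trivial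
  have h1 : isotypicProj i X ≫ f = isotypicProj i X ≫ f ≫ isotypicProj i Y := by
    conv_lhs => rw [← Category.comp_id f, ← hsum Y]
    rw [Preadditive.comp_sum, Preadditive.comp_sum, Finset.sum_eq_single ⟨i, trivial⟩]
    · intro j _ hj
      exact isotypicProj_comp_eq_zero (fun h => hj (Subtype.ext h.symm)) f
    · simp
  have h2 : f ≫ isotypicProj i Y = isotypicProj i X ≫ f ≫ isotypicProj i Y := by
    conv_lhs => rw [← Category.id_comp f, ← hsum X]
    rw [Category.assoc, Preadditive.sum_comp, Finset.sum_eq_single ⟨i, trivial⟩]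
    · intro j _ hj
      exact isotypicProj_comp_eq_zero (fun h => hj (Subtype.ext h)) f
    · simp
  exact h1.trans h2.symm

theorem isotypicProj_self (i : Irr C) : isotypicProj i i.rep = 𝟙 i.rep := by
  have h := (FusionSubcategory.top C).sum_outB_inB (X := i.rep) trivial
  rw [Finset.sum_eq_single ⟨i, trivial⟩] at h
  · exact h
  · intro j _ hj
    refine Finset.sum_eq_zero fun α _ => ?_
    rw [comp_eq_zero_of_ne (fun h => hj (Subtype.ext h)) (inB j.1.rep i.rep α), comp_zero]
  · simp

theorem isotypicProj_of_ne {i j : Irr C} (h : i ≠ j) : isotypicProj i j.rep = 0 := by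
  refine Finset.sum_eq_zero fun α _ => ?_
  rw [comp_eq_zero_of_ne h (inB i.rep j.rep α), comp_zero]

/-- The central element given by a natural endomorphism of the identity. -/
noncomputable def CE.ofNat (φ : ∀ X : C, X ⟶ X)
    (hφ : ∀ {X Y : C} (f : X ⟶ Y), φ X ≫ f = f ≫ φ Y) : CE K :=
  Z.lift (fun X _ => η_ X Xᘁ ≫ φ X ▷ Xᘁ ≫ X ◁ (λ_ Xᘁ).inv) (by
    intro X Y hX hY f
    have h := coevaluation_comp_rightAdjointMate f
    calc
      _ = η_ X Xᘁ ≫ (φ X ≫ f) ▷ Xᘁ ⊗≫ 𝟙 _ := by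
        rw [Category.assoc, Category.assoc, whisker_exchange]; monoidal
      _ = (η_ Y Yᘁ ≫ Y ◁ fᘁ) ≫ φ Y ▷ Xᘁ ⊗≫ 𝟙 _ := by rw [hφ, h]; monoidal
      _ = η_ Y Yᘁ ≫ (Y ◁ fᘁ ≫ φ Y ▷ Xᘁ) ⊗≫ 𝟙 _ := by monoidal
      _ = _ := by rw [whisker_exchange]; monoidal)

variable {K}

/-- By a zigzag identity the components of `b` can be recovered from `CE.ψ b`, so a central element
is determined by its natural endomorphism. -/
theorem CE.comp_π (b : CE K) (X : C) (hX : K.carrier X) :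
    b ≫ Z.π K (𝟙_ C) X hX = η_ X Xᘁ ≫ CE.ψ b X hX ▷ Xᘁ ≫ X ◁ (λ_ Xᘁ).inv := by
  symm
  simp only [CE.ψ]
  generalize b ≫ Z.π K (𝟙_ C) X hX = B
  calc
    _ = 𝟙 _ ⊗≫ (𝟙_ C ◁ η_ X Xᘁ ≫ B ▷ (X ⊗ Xᘁ)) ⊗≫ X ◁ ε_ X Xᘁ ▷ Xᘁ ⊗≫ 𝟙 _ := by monoidal
    _ = B ⊗≫ X ◁ (Xᘁ ◁ η_ X Xᘁ ⊗≫ ε_ X Xᘁ ▷ Xᘁ) ⊗≫ 𝟙 _ := by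
      rw [whisker_exchange]; monoidal
    _ = B := by rw [ExactPairing.coevaluation_evaluation'']; monoidal

theorem CE.ext_simple {b b' : CE K} (h : ∀ i : Idx K, CE.ψ b i.1.rep i.2 = CE.ψ b' i.1.rep i.2) :
    b = b' := by
  apply Z.hom_ext
  intro X hX
  rw [CE.comp_π, CE.comp_π]
  congr 3
  refine K.hom_ext_right hX fun i q => ?_
  rw [← CE.ψ_naturality b i.2 hX, ← CE.ψ_naturality b' i.2 hX, h]

/-- The natural endomorphism attached to a central element, evaluated at an object. -/
noncomputable def CE.ψₗ (X : C) (hX : K.carrier X) : CE K →ₗ[ℂ] (X ⟶ X) where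
  toFun b := CE.ψ b X hX
  map_add' b b' := by simp [CE.ψ, monoidalComp]
  map_smul' c b := by simp [CE.ψ, monoidalComp]

variable (K)

theorem finrank_CE_le : Module.finrank ℂ (CE K) ≤ Fintype.card (Idx K) := by
  let F : CE K →ₗ[ℂ] (Idx K → ℂ) :=
    LinearMap.pi fun i => (scalar i.1.rep).toLinearMap ∘ₗ CE.ψₗ i.1.rep i.2
  have hF : Function.Injective F := by
    intro b b' h
    refine CE.ext_simple fun i => ?_
    exact (scalar i.1.rep).injective (congrFun h i)
  simpa using LinearMap.finrank_le_finrank_of_injective hF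

variable {K}
variable (a : PivotalStructure C)

theorem CE.ofNat_chi (φ : ∀ X : C, X ⟶ X)
    (hφ : ∀ {X Y : C} (f : X ⟶ Y), φ X ≫ f = f ≫ φ Y) (X : C) (hX : K.carrier X) :
    CE.ofNat K φ hφ ≫ a.chi K X hX = η_ X Xᘁ ≫ φ X ▷ Xᘁ ≫ a.ev X := by
  rw [PivotalStructure.chi, CE.ofNat, ← Category.assoc, Z.lift_π, PivotalStructure.ev₀]
  simp

/-- Pairing a linear relation with the central element of the `j`-th isotypic projection isolates
the `j`-th coefficient, multiplied by the nonzero right dimension. -/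
theorem linearIndependent_chi :
    LinearIndependent ℂ fun i : Idx K => a.chi K i.1.rep i.2 := by
  rw [Fintype.linearIndependent_iff]
  intro c hc j
  have h := congrArg (fun f => CE.ofNat K (isotypicProj j.1) (isotypicProj_naturality j.1) ≫ f) hc
  simp only [Preadditive.comp_sum, Linear.comp_smul, CE.ofNat_chi, comp_zero] at h
  rw [Finset.sum_eq_single j] at h
  · rw [isotypicProj_self, id_whiskerRight, Category.id_comp] at h
    have h2 := congrArg (scalar (𝟙_ C)) h
    rw [map_smul, map_zero] at h2
    exact (mul_eq_zero.1 h2).resolve_right (a.dimR_ne_zero j.1.rep)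
  · intro i _ hi
    rw [isotypicProj_of_ne (fun h => hi (Subtype.ext h.symm))]
    simp
  · simp

variable (K) in
theorem finrank_CF_eq_finrank_CE : Module.finrank ℂ (CF K) = Module.finrank ℂ (CE K) :=
  (finrank_hom_comm (𝟙_ C) (A K)).symm

/-- Independence of the characters bounds the dimension below. Above, `CF` is dual to `CE` under
composition, and a central element has one scalar per simple object. -/
theorem finrank_CF (a : PivotalStructure C) (K : FusionSubcategory C) :
    Module.finrank ℂ (CF K) = Fintype.card (Idx K) :=
  le_antisymm ((finrank_CF_eq_finrank_CE K).trans_le (finrank_CE_le K))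
    (linearIndependent_chi a).fintype_card_le_finrank

/-- The basis of the class functions given by the simple objects. -/
noncomputable def chiBasis (K : FusionSubcategory C) : Module.Basis (Idx K) ℂ (CF K) :=
  Module.Basis.mk (linearIndependent_chi a)
    ((linearIndependent_chi a).span_eq_top_of_card_eq_finrank' (finrank_CF a K).symm).ge

@[simp]
theorem chiBasis_apply (i : Idx K) : chiBasis a K i = a.chi K i.1.rep i.2 := by
  simp [chiBasis]

theorem chiBasis_repr_chi {X : C} (hX : K.carrier X) (i : Idx K) :
    (chiBasis a K).repr (a.chi K X hX) i = Module.finrank ℂ (i.1.rep ⟶ X) := by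
  rw [a.chi_eq_sum hX]
  simp only [← chiBasis_apply, map_sum, map_smul, Module.Basis.repr_self]
  simp [Finsupp.single_apply]

end Basis

section Commutative

variable {K : FusionSubcategory C}

theorem finrank_hom_tensor_comm (hcomm : ∀ x y : Gr C ℤ, Gr.mul ℤ x y = Gr.mul ℤ y x)
    (i j k : Irr C) :
    Module.finrank ℂ (k.rep ⟶ i.rep ⊗ j.rep) = Module.finrank ℂ (k.rep ⟶ j.rep ⊗ i.rep) := by
  have h := hcomm (Finsupp.single i 1) (Finsupp.single j 1)
  rw [Gr.mul_single, Gr.mul_single] at h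
  have := DFunLike.congr_fun h k
  simpa [Gr.cls] using this

/-- On basis elements the products are the characters of `V_i ⊗ V_j` and `V_j ⊗ V_i`. These objects
have equal multiplicities, and characters see nothing else. -/
theorem star_comm (a : PivotalStructure C)
    (hcomm : ∀ x y : Gr C ℤ, Gr.mul ℤ x y = Gr.mul ℤ y x) (f g : CF K) :
    CF.star f g = CF.star g f := by
  have h : CF.starₗ K = (CF.starₗ K).flip := by
    refine (chiBasis a K).ext fun i => (chiBasis a K).ext fun j => ?_
    rw [LinearMap.flip_apply, chiBasis_apply, chiBasis_apply, CF.starₗ_apply, CF.starₗ_apply,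
      a.chi_star_chi, a.chi_star_chi]
    exact a.chi_congr _ _ fun k => finrank_hom_tensor_comm hcomm _ _ _
  exact LinearMap.congr_fun (LinearMap.congr_fun h f) g

end Commutative

end ClassFunctions

/-! ### The handle slide: the dimension-weighted sum of characters is a cointegral. -/

section HandleSlide

variable {C : Type u} [Category.{v} C] [Abelian C] [Linear ℂ C] [MonoidalCategory C]
  [MonoidalPreadditive C] [MonoidalLinear ℂ C] [RigidCategory C] [IsFusionCategory C]

namespace PivotalStructure

variable (a : PivotalStructure C)

/-- The coevaluation `𝟙 ⟶ X ⊗ (𝟙 ⊗ X*)`. -/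
def coev₀ (X : C) : 𝟙_ C ⟶ X ⊗ (𝟙_ C ⊗ Xᘁ) := η_ X Xᘁ ≫ X ◁ (λ_ Xᘁ).inv

/-- The mate `X* ⊗ V ⟶ Y` of a morphism `V ⟶ X ⊗ Y`. -/
def mateIn {X Y V : C} (q : V ⟶ X ⊗ Y) : Xᘁ ⊗ V ⟶ Y := Xᘁ ◁ q ⊗≫ ε_ X Xᘁ ▷ Y ⊗≫ 𝟙 Y

/-- The mate `Y ⟶ X* ⊗ V` of a morphism `X ⊗ Y ⟶ V`. -/
def mateOut {X Y V : C} (p : X ⊗ Y ⟶ V) : Y ⟶ Xᘁ ⊗ V := 𝟙 Y ⊗≫ a.coev X ▷ Y ⊗≫ Xᘁ ◁ p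

theorem mateOut_sum_smul {X Y V : C} {ι : Type*} (s : Finset ι) (c : ι → ℂ)
    (p : ι → (X ⊗ Y ⟶ V)) :
    a.mateOut (∑ k ∈ s, c k • p k) = ∑ k ∈ s, c k • a.mateOut (p k) := by
  simp [mateOut, monoidalComp, whiskerLeft_sum, Preadditive.comp_sum]

theorem mateOut_surjective {X Y V : C} (h : Y ⟶ Xᘁ ⊗ V) : ∃ p : X ⊗ Y ⟶ V, a.mateOut p = h := by
  refine ⟨X ◁ h ⊗≫ a.ev X ▷ V ⊗≫ 𝟙 V, ?_⟩
  rw [mateOut]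
  calc
    _ = 𝟙 _ ⊗≫ (a.coev X ▷ Y ≫ (Xᘁ ⊗ X) ◁ h) ⊗≫ Xᘁ ◁ a.ev X ▷ V ⊗≫ 𝟙 _ := by monoidal
    _ = h ⊗≫ (a.coev X ▷ Xᘁ ⊗≫ Xᘁ ◁ a.ev X) ▷ V ⊗≫ 𝟙 _ := by
      rw [← whisker_exchange]; monoidal
    _ = h := by rw [coev_ev_left]; monoidal

theorem mateOut_mateIn {X Y V : C} (p : X ⊗ Y ⟶ V) (q : V ⟶ X ⊗ Y) :
    a.mateOut p ≫ mateIn q = a.ptrL X (p ≫ q) := by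
  rw [mateOut, mateIn, ptrL]
  monoidal

/-- Both sides are the trace of `p ≫ q`, computed on `Y` through the partial trace and on `V`
through cyclicity. Passing to mates thus keeps dual bases dual up to a ratio of dimensions. -/
theorem scalar_mateOut_mateIn {X Y V : C} [Simple Y] [Simple V] (p : X ⊗ Y ⟶ V)
    (q : V ⟶ X ⊗ Y) :
    a.dimL Y * scalar Y (a.mateOut p ≫ mateIn q) = a.dimL V * scalar V (q ≫ p) := by
  rw [mul_comm, ← scalar_trL, mateOut_mateIn, trL_ptrL, trL_comm, scalar_trL, mul_comm]

/-- The morphism `V ⊗ V* ⟶ X ⊗ X*` given by an endomorphism of `X* ⊗ V`. -/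
def slide (X V : C) (θ : Xᘁ ⊗ V ⟶ Xᘁ ⊗ V) : V ⊗ (𝟙_ C ⊗ Vᘁ) ⟶ X ⊗ (𝟙_ C ⊗ Xᘁ) :=
  𝟙 _ ⊗≫ η_ X Xᘁ ▷ (V ⊗ Vᘁ) ⊗≫ X ◁ (θ ▷ Vᘁ) ⊗≫ (X ⊗ Xᘁ) ◁ a.ev V ⊗≫ 𝟙 _

theorem slide_sum {X V : C} {ι : Type*} (s : Finset ι) (θ : ι → (Xᘁ ⊗ V ⟶ Xᘁ ⊗ V)) :
    a.slide X V (∑ k ∈ s, θ k) = ∑ k ∈ s, a.slide X V (θ k) := by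
  simp [slide, monoidalComp, whiskerLeft_sum, sum_whiskerRight, Preadditive.comp_sum,
    Preadditive.sum_comp]

theorem slide_smul {X V : C} (c : ℂ) (θ : Xᘁ ⊗ V ⟶ Xᘁ ⊗ V) :
    a.slide X V (c • θ) = c • a.slide X V θ := by
  simp [slide, monoidalComp]

theorem slide_id (X V : C) : a.slide X V (𝟙 _) = a.ev₀ V ≫ coev₀ X := by
  calc
    _ = 𝟙 _ ⊗≫ (η_ X Xᘁ ▷ (V ⊗ Vᘁ) ≫ (X ⊗ Xᘁ) ◁ a.ev V) ⊗≫ 𝟙 _ := by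
      rw [slide]; monoidal
    _ = _ := by rw [← whisker_exchange, ev₀, coev₀]; monoidal

/-- Graphically: straightening the bend on the first mate returns `q`, while `p` is pushed through
the evaluation of `V` onto the dual strand. -/
theorem slide_mate {X Y V : C} (p : X ⊗ Y ⟶ V) (q : V ⟶ X ⊗ Y) :
    a.slide X V (mateIn q ≫ a.mateOut p) =
      V ◁ (𝟙_ C ◁ pᘁ) ≫ q ▷ (𝟙_ C ⊗ (X ⊗ Y)ᘁ) ≫ (X ⊗ Y) ◁ (𝟙_ C ◁ (rightDualTensorIso X Y).hom) ⊗≫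
        X ◁ (a.ev₀ Y ▷ Xᘁ) ⊗≫ 𝟙 _ := by
  have hq : (𝟙 V ⊗≫ η_ X Xᘁ ▷ V ⊗≫ X ◁ mateIn q : V ⟶ X ⊗ Y) = q := by
    rw [mateIn]
    calc
      _ = 𝟙 _ ⊗≫ (η_ X Xᘁ ▷ V ≫ (X ⊗ Xᘁ) ◁ q) ⊗≫ X ◁ ε_ X Xᘁ ▷ Y ⊗≫ 𝟙 _ := by monoidal
      _ = q ⊗≫ (η_ X Xᘁ ▷ X ⊗≫ X ◁ ε_ X Xᘁ) ▷ Y ⊗≫ 𝟙 _ := by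
        rw [← whisker_exchange]; monoidal
      _ = q := by rw [ExactPairing.evaluation_coevaluation'']; monoidal
  calc
    _ = 𝟙 _ ⊗≫ (𝟙 V ⊗≫ η_ X Xᘁ ▷ V ⊗≫ X ◁ mateIn q : V ⟶ X ⊗ Y) ▷ Vᘁ ⊗≫ X ◁ (a.coev X ▷ Y) ▷ Vᘁ ⊗≫
        (X ⊗ Xᘁ) ◁ (p ▷ Vᘁ ≫ a.ev V) ⊗≫ 𝟙 _ := by
      rw [slide, mateOut]; monoidal
    _ = 𝟙 _ ⊗≫ q ▷ Vᘁ ⊗≫ X ◁ (a.coev X ▷ (Y ⊗ Vᘁ) ≫ (Xᘁ ⊗ X) ◁ (Y ◁ (pᘁ ≫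
        (rightDualTensorIso X Y).hom))) ⊗≫ (X ⊗ Xᘁ) ◁ (X ◁ (a.ev Y ▷ Xᘁ) ⊗≫ a.ev X) ⊗≫ 𝟙 _ := by
      rw [hq, ev_naturality, ← ev_tensor]; monoidal
    _ = 𝟙 _ ⊗≫ (q ▷ Vᘁ ≫ (X ⊗ Y) ◁ (pᘁ ≫ (rightDualTensorIso X Y).hom)) ⊗≫
        X ◁ (a.coev X ▷ ((Y ⊗ Yᘁ) ⊗ Xᘁ) ≫ (Xᘁ ⊗ X) ◁ (a.ev Y ▷ Xᘁ)) ⊗≫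
        (X ⊗ Xᘁ) ◁ (a.ev X) ⊗≫ 𝟙 _ := by
      rw [← whisker_exchange]; monoidal
    _ = 𝟙 _ ⊗≫ (V ◁ (pᘁ ≫ (rightDualTensorIso X Y).hom) ≫ q ▷ (Yᘁ ⊗ Xᘁ)) ⊗≫
        X ◁ (a.ev Y ▷ Xᘁ) ⊗≫ X ◁ (a.coev X ▷ Xᘁ ⊗≫ Xᘁ ◁ a.ev X) ⊗≫ 𝟙 _ := by
      rw [← whisker_exchange, ← whisker_exchange]; monoidal
    _ = V ◁ (𝟙_ C ◁ pᘁ) ≫ (V ◁ (𝟙_ C ◁ (rightDualTensorIso X Y).hom) ≫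
        q ▷ (𝟙_ C ⊗ (Yᘁ ⊗ Xᘁ))) ⊗≫ X ◁ (a.ev₀ Y ▷ Xᘁ) ⊗≫ 𝟙 _ := by
      rw [coev_ev_left, ev₀]; monoidal
    _ = _ := by rw [whisker_exchange]; monoidal

/-- Test on morphisms from a simple object, each of which is a `mateOut p`. Expanding `p` in the
basis `outB`, the dimensions supply exactly the factor in `scalar_mateOut_mateIn`. -/
theorem sum_mate (K : FusionSubcategory C) {X V : C} [Simple V] (hX : K.carrier X)
    (hV : K.carrier V) :
    ∑ i : Idx K, a.dimL i.1.rep • ∑ α, mateIn (inB V (X ⊗ i.1.rep) α) ≫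
      a.mateOut (outB V (X ⊗ i.1.rep) α) = a.dimL V • 𝟙 (Xᘁ ⊗ V) := by
  refine K.hom_ext_right (K.tensor (K.rightDual hX) hV) fun j h => ?_
  rw [Preadditive.comp_sum, Finset.sum_eq_single j]
  · obtain ⟨p, rfl⟩ := a.mateOut_surjective h
    rw [Linear.comp_smul, Linear.comp_smul, Category.comp_id]
    conv_rhs => rw [← sum_scalar_outB p, mateOut_sum_smul]
    rw [Preadditive.comp_sum, Finset.smul_sum, Finset.smul_sum]
    refine Finset.sum_congr rfl fun α _ => ?_
    rw [← Category.assoc, ← scalar_smul (a.mateOut p ≫ mateIn _), Linear.smul_comp,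
      Category.id_comp, smul_smul, smul_smul, scalar_mateOut_mateIn]
  · intro i _ hij
    rw [Linear.comp_smul, Preadditive.comp_sum, Finset.sum_eq_zero, smul_zero]
    intro α _
    rw [← Category.assoc, comp_eq_zero_of_ne (fun h => hij (Subtype.ext h.symm)) (h ≫ mateIn _),
      zero_comp]
  · simp

/-- The cointegral `∑ dim(V_i) χ_i`. -/
noncomputable def regular (K : FusionSubcategory C) : CF K :=
  ∑ i : Idx K, a.dimL i.1.rep • a.chi K i.1.rep i.2

variable {K : FusionSubcategory C}

theorem coact_chi_eq_sum {X Y : C} (hX : K.carrier X) (hY : K.carrier Y) :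
    CF.coact (a.chi K Y hY) X hX = ∑ k : Idx K, ∑ α, Z.π K (𝟙_ C) k.1.rep k.2 ≫
      a.slide X k.1.rep (mateIn (inB k.1.rep (X ⊗ Y) α) ≫
        a.mateOut (outB k.1.rep (X ⊗ Y) α)) := by
  have hXY := K.tensor hX hY
  have h : Z.π K (𝟙_ C) (X ⊗ Y) hXY = Z.π K (𝟙_ C) (X ⊗ Y) hXY ≫
      (𝟙 (X ⊗ Y)) ▷ (𝟙_ C ⊗ (X ⊗ Y)ᘁ) := by rw [id_whiskerRight, Category.comp_id]
  have h2 : CF.coact (a.chi K Y hY) X hX = Z.π K (𝟙_ C) (X ⊗ Y) hXY ≫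
      ((X ⊗ Y) ◁ (𝟙_ C ◁ (rightDualTensorIso X Y).hom) ⊗≫ X ◁ (a.ev₀ Y ▷ Xᘁ) ⊗≫
        𝟙 (X ⊗ (𝟙_ C ⊗ Xᘁ))) := by
    rw [coact_chi, Z.πTensor]; monoidal
  rw [h2, h, ← K.sum_outB_inB hXY]
  simp only [sum_whiskerRight, Preadditive.sum_comp, Preadditive.comp_sum]
  refine Finset.sum_congr rfl fun k _ => Finset.sum_congr rfl fun α _ => ?_
  rw [slide_mate, comp_whiskerRight, ← Category.assoc (Z.π K (𝟙_ C) (X ⊗ Y) hXY),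
    Z.condition hXY k.2]
  simp only [Category.assoc]

/-- Decompose every `X ⊗ V_i` into simple objects `V_k` and exchange the sums. For fixed `k` the sum
over `i` is the resolution of the identity `sum_mate`, which disconnects the two strands
(`slide_id`). -/
theorem coact_regular {X : C} (hX : K.carrier X) :
    CF.coact (a.regular K) X hX = a.regular K ≫ coev₀ X := by
  have h : ∀ k : Idx K, ∑ i : Idx K, a.dimL i.1.rep • ∑ α, a.slide X k.1.rep
      (mateIn (inB k.1.rep (X ⊗ i.1.rep) α) ≫ a.mateOut (outB k.1.rep (X ⊗ i.1.rep) α)) =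
      a.dimL k.1.rep • (a.ev₀ k.1.rep ≫ coev₀ X) := by
    intro k
    rw [← slide_id, ← slide_smul, ← a.sum_mate K hX k.2]
    simp only [slide_sum, slide_smul]
  rw [regular, CF.coact_sum, Preadditive.sum_comp]
  simp only [CF.coact_smul, coact_chi_eq_sum]
  simp only [Finset.smul_sum]
  rw [Finset.sum_comm]
  refine Finset.sum_congr rfl fun k _ => ?_
  rw [Linear.smul_comp, chi, Category.assoc, ← Linear.comp_smul, ← h k, Preadditive.comp_sum]
  refine Finset.sum_congr rfl fun i _ => ?_
  rw [Linear.comp_smul, Preadditive.comp_sum, Finset.smul_sum]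

end PivotalStructure

variable {K : FusionSubcategory C}

theorem unitA_π (X : C) (hX : K.carrier X) :
    unitA K ≫ Z.π K (𝟙_ C) X hX = PivotalStructure.coev₀ X := Z.lift_π _ _ _ _

theorem isCointegral_iff (t : CF K) :
    IsCointegral t ↔ ∀ (X : C) (hX : K.carrier X),
      CF.coact t X hX = t ≫ PivotalStructure.coev₀ X := by
  have h1 : ∀ (X : C) (hX : K.carrier X), (Z.comul K (𝟙_ C) ≫ Z.map K t) ≫ Z.π K _ X hX =
      CF.coact t X hX := by
    intro X hX
    rw [Category.assoc, Z.map_π, CF.coact]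
  have h2 : ∀ (X : C) (hX : K.carrier X), (t ≫ unitA K) ≫ Z.π K _ X hX =
      t ≫ PivotalStructure.coev₀ X := by
    intro X hX
    rw [Category.assoc, unitA_π]
  constructor
  · intro h X hX
    rw [← h1, ← h2]
    exact congrArg (· ≫ Z.π K _ X hX) h
  · intro h
    refine Z.hom_ext fun X hX => ?_
    rw [h1, h2, h]

theorem isCointegral_regular (a : PivotalStructure C) : IsCointegral (a.regular K) :=
  (isCointegral_iff _).2 fun _ hX => a.coact_regular hX

/-- The value `⟨f, u⟩` of a class function at the unit. -/
noncomputable def CF.counit (f : CF K) : ℂ := scalar (𝟙_ C) (unitA K ≫ f)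

theorem CF.counit_smul_id (f : CF K) : f.counit • 𝟙 (𝟙_ C) = unitA K ≫ f := scalar_smul _

theorem IsCointegral.star_left {t : CF K} (h : IsCointegral t) (f : CF K) :
    CF.star f t = f.counit • t := by
  have h1 : Z.comul K (𝟙_ C) ≫ Z.map K t = t ≫ unitA K := h
  rw [CF.star, ← Category.assoc, h1, Category.assoc, ← CF.counit_smul_id, Linear.comp_smul,
    Category.comp_id]

end HandleSlide

/-! ### A hermitian form shows that class functions have no nilpotents. -/

section Reduced

variable {C : Type u} [Category.{v} C] [Abelian C] [Linear ℂ C] [MonoidalCategory C]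
  [MonoidalPreadditive C] [MonoidalLinear ℂ C] [RigidCategory C] [IsFusionCategory C]

theorem finrank_hom_tensor_rightDual (X V W : C) [Simple V] [Simple W] :
    Module.finrank ℂ (W ⟶ X ⊗ V) = Module.finrank ℂ (V ⟶ Xᘁ ⊗ W) := by
  rw [finrank_hom_comm V]
  let e : (Xᘁ ⊗ W ⟶ V) ≃ₗ[ℂ] (W ⟶ X ⊗ V) :=
    { tensorLeftHomEquiv W X Xᘁ V with
      map_add' := fun f g => by simp [tensorLeftHomEquiv]
      map_smul' := fun c f => by simp [tensorLeftHomEquiv] }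
  exact e.finrank_eq.symm

variable (a : PivotalStructure C) {K : FusionSubcategory C}

/-- The coordinates of a class function in the basis of the `χ_i`. -/
noncomputable def coord (f : CF K) (i : Idx K) : ℂ := (chiBasis a K).repr f i

theorem sum_coord (f : CF K) : ∑ i, coord a f i • a.chi K i.1.rep i.2 = f := by
  have := (chiBasis a K).sum_repr f
  simpa only [chiBasis_apply, coord] using this

theorem coord_chi_star {X : C} (hX : K.carrier X) (f : CF K) (k : Idx K) :
    coord a (CF.star (a.chi K X hX) f) k =
      ∑ j : Idx K, coord a f j * Module.finrank ℂ (k.1.rep ⟶ X ⊗ j.1.rep) := by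
  conv_lhs => rw [← sum_coord a f]
  rw [← CF.starₗ_apply, map_sum]
  simp only [map_smul, CF.starₗ_apply, a.chi_star_chi, coord, map_sum, Finsupp.coe_finsetSum,
    Finset.sum_apply, Finsupp.smul_apply, chiBasis_repr_chi, smul_eq_mul]

/-- The hermitian form for which the `χ_i` are orthonormal. -/
noncomputable def herm (f g : CF K) : ℂ := ∑ i, (starRingEnd ℂ) (coord a f i) * coord a g i

theorem herm_self_eq_zero {f : CF K} (h : herm a f f = 0) : f = 0 := by
  have h1 : ∀ i, (starRingEnd ℂ) (coord a f i) * coord a f i =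
      ((Complex.normSq (coord a f i) : ℝ) : ℂ) :=
    fun i => Complex.normSq_eq_conj_mul_self.symm
  simp only [herm, h1, ← Complex.ofReal_sum, Complex.ofReal_eq_zero] at h
  rw [Finset.sum_eq_zero_iff_of_nonneg (fun i _ => Complex.normSq_nonneg _)] at h
  rw [← sum_coord a f]
  refine Finset.sum_eq_zero fun i hi => ?_
  rw [Complex.normSq_eq_zero.1 (h i hi), zero_smul]

/-- Frobenius reciprocity: the matrices of multiplication by `X` and by `X*` are transposes of each
other, and their entries are natural numbers. -/
theorem herm_chi_star {X : C} (hX : K.carrier X) (f g : CF K) :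
    herm a (CF.star (a.chi K X hX) f) g = herm a f (CF.star (a.chi K Xᘁ (K.rightDual hX)) g) := by
  simp only [herm, coord_chi_star, map_sum, map_mul, Finset.sum_mul, Finset.mul_sum,
    Complex.conj_natCast]
  rw [Finset.sum_comm]
  refine Finset.sum_congr rfl fun j _ => Finset.sum_congr rfl fun k _ => ?_
  rw [finrank_hom_tensor_rightDual]
  ring

theorem herm_sum_smul_left {ι : Type*} (s : Finset ι) (c : ι → ℂ) (f : ι → CF K) (g : CF K) :
    herm a (∑ k ∈ s, c k • f k) g = ∑ k ∈ s, (starRingEnd ℂ) (c k) * herm a (f k) g := by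
  simp only [herm, coord, map_sum, map_smul, Finsupp.coe_finsetSum, Finset.sum_apply,
    Finsupp.smul_apply, smul_eq_mul, map_mul, Finset.sum_mul, Finset.mul_sum]
  rw [Finset.sum_comm]
  simp only [mul_assoc]

theorem herm_sum_smul_right {ι : Type*} (s : Finset ι) (c : ι → ℂ) (f : CF K) (g : ι → CF K) :
    herm a f (∑ k ∈ s, c k • g k) = ∑ k ∈ s, c k * herm a f (g k) := by
  simp only [herm, coord, map_sum, map_smul, Finsupp.coe_finsetSum, Finset.sum_apply,
    Finsupp.smul_apply, smul_eq_mul, Finset.mul_sum]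
  rw [Finset.sum_comm]
  refine Finset.sum_congr rfl fun j _ => Finset.sum_congr rfl fun k _ => ?_
  ring

/-- The adjoint of a class function with respect to `herm`. -/
noncomputable def adj (f : CF K) : CF K :=
  ∑ i : Idx K, (starRingEnd ℂ) (coord a f i) • a.chi K i.1.repᘁ (K.rightDual i.2)

theorem herm_star (t f g : CF K) : herm a (CF.star t f) g = herm a f (CF.star (adj a t) g) := by
  conv_lhs => rw [← sum_coord a t]
  rw [adj, ← CF.starₗ_apply, ← CF.starₗ_apply, map_sum, map_sum, LinearMap.sum_apply,
    LinearMap.sum_apply]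
  simp only [map_smul, LinearMap.smul_apply, CF.starₗ_apply]
  rw [herm_sum_smul_left, herm_sum_smul_right]
  simp only [herm_chi_star]

/-- Write `t'` for the adjoint of `t`. Then `⟨t' t, t' t⟩ = ⟨t t' t, t⟩ = 0` by commutativity, so
`t' t = 0`. Hence `⟨t, t⟩ = ⟨χ_𝟙, t' t⟩ = 0`, where `χ_𝟙` is the unit of the algebra. -/
theorem eq_zero_of_star_self (a : PivotalStructure C)
    (hcomm : ∀ x y : Gr C ℤ, Gr.mul ℤ x y = Gr.mul ℤ y x) {t : CF K}
    (h : CF.star t t = 0) : t = 0 := by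
  have star_zero : ∀ f : CF K, CF.star f 0 = 0 := fun f => by
    rw [← CF.starₗ_apply, map_zero]
  have herm_zero : ∀ f : CF K, herm a f 0 = 0 := fun f => by simp [herm, coord]
  have h1 : CF.star (adj a t) t = 0 := by
    apply herm_self_eq_zero a
    rw [← herm_star, ← CF.star_assoc, star_comm a hcomm t, CF.star_assoc, h, star_zero]
    simp [herm, coord]
  have h2 : CF.star t (a.chi K (𝟙_ C) K.unit) = t := by
    conv_rhs => rw [← sum_coord a t]
    conv_lhs => rw [← sum_coord a t]
    rw [← CF.starₗ_apply, map_sum, LinearMap.sum_apply]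
    refine Finset.sum_congr rfl fun j _ => ?_
    rw [map_smul, LinearMap.smul_apply, CF.starₗ_apply, a.chi_star_chi, a.chi_iso _ j.2 (ρ_ _)]
  have h3 : herm a t t = 0 := by
    calc
      _ = herm a (CF.star t (a.chi K (𝟙_ C) K.unit)) t := by rw [h2]
      _ = 0 := by rw [herm_star, h1, herm_zero]
  exact herm_self_eq_zero a h3

end Reduced

/-! ### Existence and uniqueness of the idempotent cointegral. -/

section Cointegral

variable {C : Type u} [Category.{v} C] [Abelian C] [Linear ℂ C] [MonoidalCategory C]
  [MonoidalPreadditive C] [MonoidalLinear ℂ C] [RigidCategory C] [IsFusionCategory C]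
  (a : PivotalStructure C) (hcomm : ∀ x y : Gr C ℤ, Gr.mul ℤ x y = Gr.mul ℤ y x)
  (K : FusionSubcategory C)

theorem regular_ne_zero : a.regular K ≠ 0 := by
  intro h
  obtain ⟨i, ⟨e⟩⟩ := Irr.exists_iso_rep (𝟙_ C) inferInstance
  have hi : K.carrier i.rep := K.summand ⟨e.inv, e.hom, e.inv_hom_id⟩ K.unit
  have := Fintype.linearIndependent_iff.1 (linearIndependent_chi (K := K) a) _ h ⟨i, hi⟩
  exact a.dimL_ne_zero _ this

include a hcomm

theorem counit_regular_ne_zero : (a.regular K).counit ≠ 0 := by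
  intro h
  have h1 := (isCointegral_regular (K := K) a).star_left (a.regular K)
  rw [h, zero_smul] at h1
  exact regular_ne_zero a K (eq_zero_of_star_self a hcomm h1)

theorem isIdempotentCointegral_regular :
    IsIdempotentCointegral ((a.regular K).counit⁻¹ • a.regular K) := by
  constructor
  · have h : Z.comul K (𝟙_ C) ≫ Z.map K (a.regular K) = a.regular K ≫ unitA K :=
      isCointegral_regular a
    rw [IsCointegral, Z.map_smul, Linear.comp_smul, h, Linear.smul_comp]
  · rw [Linear.comp_smul, ← CF.counit_smul_id, smul_smul,
      inv_mul_cancel₀ (counit_regular_ne_zero a hcomm K), one_smul]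

/-- The cointegral property gives `t' ⋆ t = t` and `t ⋆ t' = t'`; commutativity equates them. -/
theorem IsIdempotentCointegral.unique {K : FusionSubcategory C} {t t' : CF K}
    (h : IsIdempotentCointegral t) (h' : IsIdempotentCointegral t') : t = t' := by
  have h1 := h.1.star_left t'
  have h2 := h'.1.star_left t
  rw [CF.counit, h'.2, scalar_id, one_smul] at h1
  rw [CF.counit, h.2, scalar_id, one_smul] at h2
  rw [← h1, star_comm a hcomm]
  exact h2

theorem existsUnique_isIdempotentCointegral : ∃! t : CF K, IsIdempotentCointegral t :=
  ⟨_, isIdempotentCointegral_regular a hcomm K, fun _ h =>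
    h.unique a hcomm (isIdempotentCointegral_regular a hcomm K)⟩

theorem isIdempotentCointegral_cointegral : IsIdempotentCointegral (cointegral K) :=
  Classical.epsilon_spec (existsUnique_isIdempotentCointegral a hcomm K).exists

theorem cointegral_eq : cointegral K = (a.regular K).counit⁻¹ • a.regular K :=
  (isIdempotentCointegral_cointegral a hcomm K).unique a hcomm
    (isIdempotentCointegral_regular a hcomm K)

end Cointegral

/-! ### Absorption of objects and the cointegral of a join. -/

section Lam

variable {C : Type u} [Category.{v} C] [Abelian C] [Linear ℂ C] [MonoidalCategory C]
  [MonoidalPreadditive C] [MonoidalLinear ℂ C] [RigidCategory C] [IsFusionCategory C]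

theorem mem_top (X : C) : (FusionSubcategory.top C).carrier X := trivial

theorem restrictA_π (K : FusionSubcategory C) (X : C) (hX : K.carrier X) :
    restrictA K ≫ Z.π K (𝟙_ C) X hX = Z.π (FusionSubcategory.top C) (𝟙_ C) X (mem_top _) :=
  Z.lift_π _ _ _ _

theorem coact_restrictA (K : FusionSubcategory C) (t : CF K) {X : C} (hX : K.carrier X) :
    CF.coact (restrictA K ≫ t) X (mem_top _) = restrictA K ≫ CF.coact t X hX := by
  have h : Z.comul (FusionSubcategory.top C) (𝟙_ C) ≫ Z.π (FusionSubcategory.top C) _ X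
      (mem_top _) ≫ X ◁ (restrictA K ▷ Xᘁ) = restrictA K ≫ Z.comul K (𝟙_ C) ≫ Z.π K (A K) X hX := by
    apply Z.conj_hom_ext
    intro Y hY
    have h1 := Z.comul_π_eq_πTensor K (𝟙_ C) X Y hX hY
    have h2 := Z.comul_π_eq_πTensor (FusionSubcategory.top C) (𝟙_ C) X Y (mem_top _) (mem_top _)
    have h3 : restrictA K ≫ Z.πTensor K (𝟙_ C) X Y hX hY =
        Z.πTensor (FusionSubcategory.top C) (𝟙_ C) X Y (mem_top _) (mem_top _) := by
      rw [Z.πTensor, ← Category.assoc, restrictA_π, Z.πTensor]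
    simp only [Category.assoc]
    rw [h1, h3, ← MonoidalCategory.whiskerLeft_comp, ← comp_whiskerRight, restrictA_π, h2]
  rw [CF.coact, comp_whiskerRight, MonoidalCategory.whiskerLeft_comp]
  have h' := congrArg (· ≫ X ◁ (t ▷ Xᘁ)) h
  simp only [Category.assoc] at h'
  rw [h', CF.coact]

/-- A class function `t` absorbs the object `X` if `X` acts on it through its dimension. -/
def Absorbs (t : CF (FusionSubcategory.top C)) (X : C) : Prop :=
  CF.coact t X (mem_top _) = t ≫ PivotalStructure.coev₀ X

namespace Absorbs

variable {t : CF (FusionSubcategory.top C)}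

theorem coact_naturality {X Y : C} (f : X ⟶ Y) :
    CF.coact t X (mem_top _) ≫ f ▷ (𝟙_ C ⊗ Xᘁ) = CF.coact t Y (mem_top _) ≫ Y ◁ (𝟙_ C ◁ fᘁ) := by
  have h := Z.condition (D := FusionSubcategory.top C) (V := A (FusionSubcategory.top C))
    (X := X) (Y := Y) (mem_top _) (mem_top _) f
  calc
    _ = Z.comul _ (𝟙_ C) ≫ Z.π (FusionSubcategory.top C) _ X (mem_top _) ≫
        (X ◁ (t ▷ Xᘁ) ≫ f ▷ (𝟙_ C ⊗ Xᘁ)) := by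
      simp only [CF.coact, Category.assoc]
    _ = Z.comul _ (𝟙_ C) ≫ (Z.π (FusionSubcategory.top C) _ X (mem_top _) ≫
        f ▷ (A (FusionSubcategory.top C) ⊗ Xᘁ)) ≫ Y ◁ (t ▷ Xᘁ) := by
      rw [whisker_exchange]; simp only [Category.assoc]
    _ = Z.comul _ (𝟙_ C) ≫ Z.π (FusionSubcategory.top C) _ Y (mem_top _) ≫
        Y ◁ (A (FusionSubcategory.top C) ◁ fᘁ ≫ t ▷ Xᘁ) := by
      rw [h]; simp only [Category.assoc, MonoidalCategory.whiskerLeft_comp]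
    _ = _ := by
      rw [whisker_exchange, CF.coact]
      simp only [Category.assoc, MonoidalCategory.whiskerLeft_comp]

theorem coev₀_naturality {X Y : C} (f : X ⟶ Y) :
    PivotalStructure.coev₀ X ≫ f ▷ (𝟙_ C ⊗ Xᘁ) =
      PivotalStructure.coev₀ Y ≫ Y ◁ (𝟙_ C ◁ fᘁ) := by
  have h := Z.condition (D := FusionSubcategory.top C) (V := 𝟙_ C) (X := X) (Y := Y)
    (mem_top _) (mem_top _) f
  rw [← unitA_π (K := FusionSubcategory.top C) X (mem_top _),
    ← unitA_π (K := FusionSubcategory.top C) Y (mem_top _), Category.assoc, Category.assoc, h]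

/-- Both sides of the absorption equation are dinatural in the object, so inserting `r.i ≫ r.r = 𝟙`
moves the comparison from `X` to `Y`. -/
theorem retract {X Y : C} (r : Retract X Y) (h : Absorbs t Y) : Absorbs t X := by
  have e : ∀ {W : C} (k : W ⟶ X ⊗ (𝟙_ C ⊗ Xᘁ)),
      k = (k ≫ r.i ▷ (𝟙_ C ⊗ Xᘁ)) ≫ r.r ▷ (𝟙_ C ⊗ Xᘁ) := fun k => by
    rw [Category.assoc, ← comp_whiskerRight, r.retract, id_whiskerRight, Category.comp_id]
  rw [Absorbs, e (CF.coact t X (mem_top _)), coact_naturality, h, e (t ≫ _),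
    Category.assoc t _ (r.i ▷ _), coev₀_naturality]
  simp only [Category.assoc]

theorem biprod {X Y : C} (hX : Absorbs t X) (hY : Absorbs t Y) : Absorbs t (X ⊞ Y) := by
  have e : ∀ {W U : C} (k : W ⟶ (X ⊞ Y) ⊗ U),
      k = (k ≫ biprod.fst ▷ U) ≫ biprod.inl ▷ U + (k ≫ biprod.snd ▷ U) ≫ biprod.inr ▷ U :=
    fun k => by
      simp only [Category.assoc, ← comp_whiskerRight]
      rw [← Preadditive.comp_add, ← MonoidalPreadditive.add_whiskerRight, biprod.total,
        id_whiskerRight, Category.comp_id]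
  rw [Absorbs, e (CF.coact t _ (mem_top _)), coact_naturality, coact_naturality, hX, hY, e (t ≫ _)]
  simp only [Category.assoc t, coev₀_naturality]

theorem coev₀_tensor (X Y : C) :
    PivotalStructure.coev₀ (X ⊗ Y) ≫
      (X ⊗ Y) ◁ (𝟙_ C ◁ (rightDualTensorIso X Y).hom) ⊗≫ 𝟙 (X ⊗ ((Y ⊗ (𝟙_ C ⊗ Yᘁ)) ⊗ Xᘁ)) =
    PivotalStructure.coev₀ X ≫ X ◁ (PivotalStructure.coev₀ Y ▷ Xᘁ) := by
  calc
    _ = (η_ (X ⊗ Y) (X ⊗ Y)ᘁ ≫ (X ⊗ Y) ◁ (rightDualTensorIso X Y).hom) ⊗≫ 𝟙 _ := by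
      rw [PivotalStructure.coev₀]; monoidal
    _ = _ := by
      rw [PivotalStructure.coevaluation_rightDualTensorIso, ExactPairing.tensor_coevaluation,
        PivotalStructure.coev₀, PivotalStructure.coev₀]
      monoidal

theorem tensor {X Y : C} (hX : Absorbs t X) (hY : Absorbs t Y) : Absorbs t (X ⊗ Y) := by
  have h : IsIso ((X ⊗ Y) ◁ (𝟙_ C ◁ (rightDualTensorIso X Y).hom) ⊗≫
      𝟙 (X ⊗ ((Y ⊗ (𝟙_ C ⊗ Yᘁ)) ⊗ Xᘁ))) := by
    rw [monoidalComp]; infer_instance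
  rw [Absorbs, ← cancel_mono ((X ⊗ Y) ◁ (𝟙_ C ◁ (rightDualTensorIso X Y).hom) ⊗≫
      𝟙 (X ⊗ ((Y ⊗ (𝟙_ C ⊗ Yᘁ)) ⊗ Xᘁ)))]
  have h1 := CF.coact_tensor t (X := X) (Y := Y) (mem_top _) (mem_top _)
  have h2 : CF.coact t X (mem_top _) ≫ X ◁ (PivotalStructure.coev₀ Y ▷ Xᘁ) =
      t ≫ PivotalStructure.coev₀ X ≫ X ◁ (PivotalStructure.coev₀ Y ▷ Xᘁ) := by
    rw [hX, Category.assoc]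
  refine h1.trans ?_
  rw [hY, comp_whiskerRight, MonoidalCategory.whiskerLeft_comp, Category.assoc, coev₀_tensor, ← h2,
    CF.coact]
  simp only [Category.assoc]

theorem star {X : C} (h : Absorbs t X) (g : CF (FusionSubcategory.top C)) :
    Absorbs (CF.star t g) X := by
  rw [Absorbs, CF.coact_star, h, CF.star]
  simp only [Category.assoc]

end Absorbs

/-- The objects obtained from those of `D` and `E` by tensor products, direct sums and direct
summands. -/
inductive Generated (D E : FusionSubcategory C) : C → Prop
  | left {X : C} : D.carrier X → Generated D E X
  | right {X : C} : E.carrier X → Generated D E X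
  | tensor {X Y : C} : Generated D E X → Generated D E Y → Generated D E (X ⊗ Y)
  | biprod {X Y : C} : Generated D E X → Generated D E Y → Generated D E (X ⊞ Y)
  | summand {X Y : C} : Retract X Y → Generated D E Y → Generated D E X

theorem Generated.rightDual {D E : FusionSubcategory C} {X : C} (h : Generated D E X) :
    Generated D E Xᘁ := by
  induction h with
  | left h => exact .left (D.rightDual h)
  | right h => exact .right (E.rightDual h)
  | tensor _ _ hX hY =>
    exact .summand ⟨(rightDualTensorIso _ _).hom, (rightDualTensorIso _ _).inv, by simp⟩
      (.tensor hY hX)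
  | @biprod X Y _ _ hX hY =>
    -- Dualising exchanges inclusions and projections, so it exhibits the dual of a biproduct as a
    -- retract of the biproduct of the duals.
    refine .summand ⟨biprod.lift (rightAdjointMate (biprod.inl : X ⟶ X ⊞ Y))
        (rightAdjointMate (biprod.inr : Y ⟶ X ⊞ Y)),
      biprod.desc (rightAdjointMate (biprod.fst : X ⊞ Y ⟶ X))
        (rightAdjointMate (biprod.snd : X ⊞ Y ⟶ Y)), ?_⟩ (.biprod hX hY)
    rw [biprod.lift_desc, ← comp_rightAdjointMate, ← comp_rightAdjointMate]
    have h := dual_sum (C := C) Finset.univ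
      ![(biprod.fst ≫ biprod.inl : X ⊞ Y ⟶ X ⊞ Y), biprod.snd ≫ biprod.inr]
    simp only [Fin.sum_univ_two, Matrix.cons_val_zero, Matrix.cons_val_one] at h
    rw [← h, biprod.total, rightAdjointMate_id]
  | summand r _ hY =>
    exact .summand ⟨r.rᘁ, r.iᘁ, by rw [← comp_rightAdjointMate, r.retract, rightAdjointMate_id]⟩ hY

/-- The fusion subcategory generated by `D` and `E`. -/
def generated (a : PivotalStructure C) (D E : FusionSubcategory C) : FusionSubcategory C where
  carrier := Generated D E
  unit := .left D.unit
  tensor := .tensor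
  rightDual := Generated.rightDual
  leftDual {X} h :=
    -- The pivotal structure makes the right dual a left dual as well, so closure under right duals
    -- suffices.
    let e : HasLeftDual.leftDual X ≅ Xᘁ := leftDualIso inferInstance (a.pairing X)
    .summand ⟨e.hom, e.inv, e.hom_inv_id⟩ h.rightDual
  biprod := .biprod
  summand := .summand

/-- Induction over `Generated`, which has no constructor for duals, avoids having to show that
absorption passes to duals. -/
theorem Absorbs.join (a : PivotalStructure C) {D E : FusionSubcategory C}
    {t : CF (FusionSubcategory.top C)} (hD : ∀ X, D.carrier X → Absorbs t X)
    (hE : ∀ X, E.carrier X → Absorbs t X) {X : C} (hX : (D.join E).carrier X) : Absorbs t X := by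
  have h : Generated D E X := hX (generated a D E) (fun _ => .left) (fun _ => .right)
  clear hX
  induction h with
  | left h => exact hD _ h
  | right h => exact hE _ h
  | tensor _ _ hX hY => exact hX.tensor hY
  | biprod _ _ hX hY => exact hX.biprod hY
  | summand r _ hY => exact hY.retract r

variable (a : PivotalStructure C) (hcomm : ∀ x y : Gr C ℤ, Gr.mul ℤ x y = Gr.mul ℤ y x)

include a hcomm

theorem absorbs_lam {K : FusionSubcategory C} {X : C} (hX : K.carrier X) : Absorbs (lam K) X := by
  rw [Absorbs, lam, coact_restrictA K _ hX,
    (isCointegral_iff _).1 (isIdempotentCointegral_cointegral a hcomm K).1 X hX, Category.assoc]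

theorem lam_eq (K : FusionSubcategory C) :
    lam K = ∑ i : Idx K, ((a.regular K).counit⁻¹ * a.dimL i.1.rep) •
      a.chi (FusionSubcategory.top C) i.1.rep (mem_top _) := by
  rw [lam, cointegral_eq a hcomm, PivotalStructure.regular, Finset.smul_sum,
    Preadditive.comp_sum]
  refine Finset.sum_congr rfl fun i _ => ?_
  rw [smul_smul, Linear.comp_smul, PivotalStructure.chi, ← Category.assoc, restrictA_π,
    PivotalStructure.chi]

/-- Each `χ_X` with `X` in `K` multiplies `t` by `a.dimR X`. Since `λ_K` is a combination of such
characters, it multiplies `t` by its own value at the unit, which is `1`. -/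
theorem lam_star {K : FusionSubcategory C} {t : CF (FusionSubcategory.top C)}
    (h : ∀ X, K.carrier X → Absorbs t X) : CF.star (lam K) t = t := by
  have h1 : ∀ X, K.carrier X →
      CF.star (a.chi (FusionSubcategory.top C) X (mem_top _)) t = a.dimR X • t := by
    intro X hX
    have h3 : PivotalStructure.coev₀ X ≫ a.ev₀ X = a.dimR X • 𝟙 (𝟙_ C) := by
      rw [← a.unitA_chi (K := FusionSubcategory.top C) (X := X) (mem_top _), PivotalStructure.chi,
        ← Category.assoc, unitA_π]
    rw [PivotalStructure.chi, CF.star_π_comp, h X hX, Category.assoc, h3, Linear.comp_smul,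
      Category.comp_id]
  have h2 : ∑ i : Idx K, ((a.regular K).counit⁻¹ * a.dimL i.1.rep) * a.dimR i.1.rep = 1 := by
    have h3 := (isIdempotentCointegral_regular a hcomm K).2
    rw [PivotalStructure.regular, Finset.smul_sum, Preadditive.comp_sum] at h3
    simp only [smul_smul, Linear.comp_smul, a.unitA_chi, ← Finset.sum_smul] at h3
    have h4 := congrArg (scalar (𝟙_ C)) h3
    simpa [PivotalStructure.regular] using h4
  rw [lam_eq a hcomm, ← CF.starₗ_apply, map_sum, LinearMap.sum_apply]
  simp only [map_smul, LinearMap.smul_apply, CF.starₗ_apply]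
  rw [Finset.sum_congr rfl fun i _ => by rw [h1 i.1.rep i.2, smul_smul], ← Finset.sum_smul, h2,
    one_smul]

theorem lam_join (D E : FusionSubcategory C) : lam (D.join E) = CF.star (lam D) (lam E) := by
  have hP : ∀ X, (D.join E).carrier X → Absorbs (CF.star (lam D) (lam E)) X := by
    intro X hX
    refine Absorbs.join a (fun X hX => (absorbs_lam a hcomm hX).star _) (fun X hX => ?_) hX
    -- `Absorbs.star` passes absorption on from the left factor only, so `λ_E` has to be moved to
    -- the left.
    rw [star_comm a hcomm]
    exact (absorbs_lam a hcomm hX).star _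
  have h1 := lam_star a hcomm hP
  have hD : CF.star (lam D) (lam (D.join E)) = lam (D.join E) :=
    lam_star a hcomm fun X hX => absorbs_lam a hcomm fun _ hD _ => hD X hX
  have hE : CF.star (lam E) (lam (D.join E)) = lam (D.join E) :=
    lam_star a hcomm fun X hX => absorbs_lam a hcomm fun _ _ hE => hE X hX
  rw [star_comm a hcomm, CF.star_assoc, hE, hD] at h1
  exact h1

end Lam

/-! ### Bijectivity of the Fourier transform. -/

section Fourier

variable {C : Type u} [Category.{v} C] [Abelian C] [Linear ℂ C] [MonoidalCategory C]
  [MonoidalPreadditive C] [MonoidalLinear ℂ C] [RigidCategory C] [IsFusionCategory C]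
  {K : FusionSubcategory C}

theorem CF.act_π_comp (b : CE K) {X : C} (hX : K.carrier X) (g : X ⊗ (𝟙_ C ⊗ Xᘁ) ⟶ 𝟙_ C) :
    CF.act (Z.π K (𝟙_ C) X hX ≫ g) b =
      Z.π K (𝟙_ C) X hX ≫ CE.ψ b X hX ▷ (𝟙_ C ⊗ Xᘁ) ≫ g := by
  have h : mulA K ≫ Z.π K (𝟙_ C) X hX =
      (Z.π K (𝟙_ C) X hX ⊗ₘ Z.π K (𝟙_ C) X hX) ⊗≫ X ◁ (ε_ X Xᘁ ▷ (𝟙_ C ⊗ Xᘁ)) ⊗≫ 𝟙 _ :=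
    Z.lift_π _ _ _ _
  rw [CF.act, ← Category.assoc (mulA K), h, CE.ψ, MonoidalCategory.tensorHom_def]
  generalize Z.π K (𝟙_ C) X hX = P
  calc
    _ = 𝟙 _ ⊗≫ ((b ≫ P) ▷ A K ≫ (X ⊗ (𝟙_ C ⊗ Xᘁ)) ◁ P) ⊗≫
        X ◁ (ε_ X Xᘁ ▷ (𝟙_ C ⊗ Xᘁ)) ⊗≫ g := by monoidal
    _ = _ := by rw [← whisker_exchange]; monoidal

theorem CF.act_chi (a : PivotalStructure C) (b : CE K) (i : Idx K) :
    CF.act (a.chi K i.1.rep i.2) b =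
      scalar i.1.rep (CE.ψ b i.1.rep i.2) • a.chi K i.1.rep i.2 := by
  rw [PivotalStructure.chi, CF.act_π_comp, ← scalar_smul (CE.ψ b i.1.rep i.2),
    MonoidalLinear.smul_whiskerRight, id_whiskerRight, Linear.smul_comp, Linear.comp_smul,
    Category.id_comp, scalar_smul]

theorem CE.antipode_π (b : CE K) (X : C) (hX : K.carrier X) :
    CE.antipode b ≫ Z.π K (𝟙_ C) X hX = η_ X Xᘁ ≫ CE.ψDual b X hX ▷ Xᘁ ≫ X ◁ (λ_ Xᘁ).inv :=
  Z.lift_π _ _ _ _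

theorem CE.ψDual_add (b b' : CE K) (X : C) (hX : K.carrier X) :
    CE.ψDual (b + b') X hX = CE.ψDual b X hX + CE.ψDual b' X hX := by
  have h : CE.ψ (b + b') _ (K.leftDual hX) = _ := (CE.ψₗ _ (K.leftDual hX)).map_add b b'
  rw [CE.ψDual, h]
  simp [rightAdjointMate, CE.ψDual, CE.ψₗ]

theorem CE.ψDual_smul (c : ℂ) (b : CE K) (X : C) (hX : K.carrier X) :
    CE.ψDual (c • b) X hX = c • CE.ψDual b X hX := by
  have h : CE.ψ (c • b) _ (K.leftDual hX) = _ := (CE.ψₗ _ (K.leftDual hX)).map_smul c b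
  rw [CE.ψDual, h]
  simp [rightAdjointMate, CE.ψDual, CE.ψₗ]

/-- The antipodal operator as a linear map. -/
noncomputable def CE.antipodeₗ (K : FusionSubcategory C) : CE K →ₗ[ℂ] CE K where
  toFun := CE.antipode
  map_add' b b' := by
    refine Z.hom_ext fun X hX => ?_
    rw [Preadditive.add_comp, CE.antipode_π, CE.antipode_π, CE.antipode_π, CE.ψDual_add]
    simp
  map_smul' c b := by
    refine Z.hom_ext fun X hX => ?_
    rw [RingHom.id_apply, Linear.smul_comp, CE.antipode_π, CE.antipode_π, CE.ψDual_smul]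
    simp

/-- The Fourier transform as a linear map. -/
noncomputable def fourierₗ (t : CF K) : CE K →ₗ[ℂ] CF K where
  toFun := fourier t
  map_add' b b' := by
    have h : CE.antipode (b + b') = CE.antipode b + CE.antipode b' :=
      (CE.antipodeₗ K).map_add b b'
    simp [fourier, CF.act, h]
  map_smul' c b := by
    have h : CE.antipode (c • b) = c • CE.antipode b := (CE.antipodeₗ K).map_smul c b
    simp [fourier, CF.act, h]

theorem CE.ψ_eq_zero_of_ψDual (b : CE K) {X : C} (hX : K.carrier X) (h : CE.ψDual b X hX = 0) :
    CE.ψ b _ (K.leftDual hX) = 0 := by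
  have h1 := coevaluation_comp_rightAdjointMate (CE.ψ b _ (K.leftDual hX))
  have h2 : rightAdjointMate (CE.ψ b _ (K.leftDual hX)) = 0 := h
  rw [h2] at h1
  simp only [MonoidalPreadditive.whiskerLeft_zero, comp_zero] at h1
  have h3 := congrArg (tensorRightHomEquiv (𝟙_ C) (HasLeftDual.leftDual X) X _).symm h1
  erw [tensorRightHomEquiv_symm_coevaluation_comp_whiskerRight] at h3
  have h4 : (tensorRightHomEquiv (𝟙_ C) (HasLeftDual.leftDual X) X
      (HasLeftDual.leftDual X)).symm 0 = 0 := by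
    simp [tensorRightHomEquiv]
  exact (cancel_epi (λ_ (HasLeftDual.leftDual X)).hom).1 (by rw [comp_zero]; exact h3.symm.trans h4)

/-- Vanishing of the antipode kills `ψ` on all left duals. Every simple object is isomorphic to the
left dual of its right dual, so `ψ` vanishes on simple objects. -/
theorem CE.eq_zero_of_antipode {b : CE K} (h : CE.antipode b = 0) : b = 0 := by
  have h1 : ∀ (X : C) (hX : K.carrier X), CE.ψ (0 : CE K) X hX = 0 :=
    fun X hX => (CE.ψₗ X hX).map_zero
  refine CE.ext_simple fun i => ?_
  rw [h1]
  have hd : CE.ψDual b i.1.repᘁ (K.rightDual i.2) = 0 := by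
    rw [← CE.ψ_antipode, h, h1]
  have h2 := CE.ψ_eq_zero_of_ψDual b _ hd
  let e : i.1.rep ≅ @HasLeftDual.leftDual C _ _ i.1.repᘁ (LeftRigidCategory.leftDual _) :=
    leftDualIso (Y := i.1.repᘁ) inferInstance (LeftRigidCategory.leftDual i.1.repᘁ).exact
  have h3 := CE.ψ_naturality b i.2 (K.leftDual (K.rightDual i.2)) e.hom
  rw [h2, comp_zero] at h3
  exact (cancel_mono e.hom).1 (by rw [h3, zero_comp])

/-- Central elements act diagonally on the characters (`CF.act_chi`). When no coordinate of `t`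
vanishes, `t ↼ S(b)` determines every scalar of `S(b)`, and the antipode is injective. -/
theorem fourier_injective (a : PivotalStructure C) {t : CF K} (ht : ∀ i, coord a t i ≠ 0) :
    Function.Injective (fourierₗ t) := by
  refine (injective_iff_map_eq_zero _).2 fun b hb => ?_
  apply CE.eq_zero_of_antipode
  have h1 : CF.act t (CE.antipode b) = 0 := hb
  have h2 : CF.act t (CE.antipode b) = ∑ i : Idx K,
      (coord a t i * scalar i.1.rep (CE.ψ (CE.antipode b) i.1.rep i.2)) •
        a.chi K i.1.rep i.2 := by
    conv_lhs => rw [← sum_coord a t]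
    simp only [CF.act, Preadditive.comp_sum, Linear.comp_smul]
    refine Finset.sum_congr rfl fun i _ => ?_
    rw [mul_smul, ← CF.act_chi, CF.act]
  rw [h2] at h1
  have h3 := Fintype.linearIndependent_iff.1 (linearIndependent_chi (K := K) a) _ h1
  refine CE.ext_simple fun i => ?_
  have h4 : scalar i.1.rep (CE.ψ (CE.antipode b) i.1.rep i.2) = 0 :=
    (mul_eq_zero.1 (h3 i)).resolve_left (ht i)
  rw [(scalar i.1.rep).map_eq_zero_iff.1 h4]
  exact ((CE.ψₗ i.1.rep i.2).map_zero).symm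

theorem bijective_fourierTransform (a : PivotalStructure C)
    (hcomm : ∀ x y : Gr C ℤ, Gr.mul ℤ x y = Gr.mul ℤ y x) :
    Function.Bijective (fourierTransform C) := by
  have h : Function.Injective (fourierₗ (cointegral (FusionSubcategory.top C))) := by
    refine fourier_injective a fun i => ?_
    have : coord a (cointegral (FusionSubcategory.top C)) i =
        (a.regular (FusionSubcategory.top C)).counit⁻¹ * a.dimL i.1.rep := by
      rw [cointegral_eq a hcomm, coord, PivotalStructure.regular]
      simp only [← chiBasis_apply, map_smul, map_sum, Module.Basis.repr_self]
      simp [Finsupp.single_apply]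
    rw [this]
    exact mul_ne_zero (inv_ne_zero (counit_regular_ne_zero a hcomm _)) (a.dimL_ne_zero _)
  exact ⟨h, (LinearMap.injective_iff_surjective_of_finrank_eq_finrank
    (finrank_CF_eq_finrank_CE _).symm).1 h⟩

end Fourier

/-! ### Decomposition of idempotents into primitive ones. -/

section PrimitiveIdempotents

variable {C : Type u} [Category.{v} C] [Abelian C] [Linear ℂ C] [MonoidalCategory C]
  [MonoidalPreadditive C] [MonoidalLinear ℂ C] [RigidCategory C] [IsFusionCategory C]
  (hc : ∀ f g : CF (FusionSubcategory.top C), CF.star f g = CF.star g f)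

theorem CF.sub_star {K : FusionSubcategory C} (f g h : CF K) :
    star (f - g) h = star f h - star g h := by
  simp only [← starₗ_apply, map_sub, LinearMap.sub_apply]

theorem CF.star_sub {K : FusionSubcategory C} (f g h : CF K) :
    star f (g - h) = star f g - star f h := by
  simp only [← starₗ_apply, map_sub]

theorem CF.zero_star {K : FusionSubcategory C} (f : CF K) : star 0 f = 0 := by
  simp only [← starₗ_apply, map_zero, LinearMap.zero_apply]

include hc

/-- The product of two primitive idempotents is an idempotent below both, so by minimality it is
zero or equal to both. -/
theorem PrimIdem.F_star_F (j k : PrimIdem C) :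
    CF.star j.F k.F = if j = k then j.F else 0 := by
  obtain ⟨e, ⟨he, -⟩, -, hmin⟩ := j
  obtain ⟨f, ⟨hf, -⟩, -, hmin'⟩ := k
  simp only [PrimIdem.F]
  have hidem : IsCentralIdempotent (CF.star e f) := by
    refine ⟨?_, fun g => hc _ g⟩
    rw [CF.star_assoc, hc f, CF.star_assoc, hf, ← CF.star_assoc, he]
  have h1 := hmin _ hidem (by rw [← CF.star_assoc, he])
  have h2 := hmin' _ hidem (by rw [hc f, CF.star_assoc, hf])
  split_ifs with h
  · have h' : e = f := congrArg (fun j : PrimIdem C => j.1) h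
    rw [← h', he]
  · rcases h1 with h1 | h1
    · exact h1
    · rcases h2 with h2 | h2
      · exact h2
      · exact absurd (h1.symm.trans h2) fun h' => h (by exact Subtype.ext h')

theorem star_sum_F (L L' : Finset (PrimIdem C)) :
    CF.star (∑ j ∈ L, j.F) (∑ j ∈ L', j.F) = ∑ j ∈ L ∩ L', j.F := by
  simp only [← CF.starₗ_apply, map_sum, LinearMap.sum_apply]
  simp only [CF.starₗ_apply, PrimIdem.F_star_F hc]
  rw [Finset.sum_comm]
  simp [Finset.sum_ite_mem]

theorem sum_F_star_F (L : Finset (PrimIdem C)) (j : PrimIdem C) :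
    CF.star (∑ k ∈ L, k.F) j.F = if j ∈ L then j.F else 0 := by
  have h := star_sum_F hc L {j}
  rw [Finset.sum_singleton] at h
  rw [h]
  split_ifs with hj
  · rw [Finset.inter_singleton_of_mem hj, Finset.sum_singleton]
  · rw [Finset.inter_singleton_of_notMem hj, Finset.sum_empty]

theorem sum_F_injective : Function.Injective fun L : Finset (PrimIdem C) => ∑ j ∈ L, j.F := by
  intro L L' h
  ext j
  have h1 := sum_F_star_F hc L j
  have h2 : ∑ j ∈ L, j.F = ∑ j ∈ L', j.F := h
  rw [h2, sum_F_star_F hc L' j] at h1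
  have hj : j.F ≠ 0 := j.2.2.1
  by_cases hL : j ∈ L <;> by_cases hL' : j ∈ L' <;> simp_all

/-- Induction on the dimension of the ideal generated by `e`. A nonprimitive `e` splits into
orthogonal idempotents `f` and `e - f`, each generating a strictly smaller ideal. -/
theorem exists_eq_sum_F (e : CF (FusionSubcategory.top C)) (he : CF.star e e = e) :
    ∃ L : Finset (PrimIdem C), e = ∑ j ∈ L, j.F := by
  induction hn : Module.finrank ℂ (LinearMap.range (CF.starₗ (FusionSubcategory.top C) e))
    using Nat.strong_induction_on generalizing e with
  | _ n ih =>
  subst hn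
  by_cases h0 : e = 0
  · exact ⟨∅, by simpa using h0⟩
  by_cases hp : ∀ f, IsCentralIdempotent f → CF.star e f = f → f = 0 ∨ f = e
  · let j : PrimIdem C := ⟨e, ⟨he, fun g => hc _ g⟩, h0, hp⟩
    exact ⟨{j}, (Finset.sum_singleton PrimIdem.F j).symm⟩
  push Not at hp
  obtain ⟨f, ⟨hf, -⟩, hef, hf0, hfe⟩ := hp
  have hfe' : CF.star f e = f := by rw [hc, hef]
  -- If `g` lies below `e` and generates the same ideal, then `g ⋆ e` equals both `e` and `g`; so `g
  -- ≠ e` forces the dimension to drop.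
  have key : ∀ g, CF.star e g = g → CF.star g g = g → g ≠ e →
      ∃ L : Finset (PrimIdem C), g = ∑ j ∈ L, j.F := by
    intro g heg hg hge
    refine ih _ (Submodule.finrank_lt_finrank_of_lt (lt_of_le_of_ne ?_ ?_)) g hg rfl
    · rintro _ ⟨x, rfl⟩
      refine ⟨CF.star g x, ?_⟩
      rw [CF.starₗ_apply, CF.starₗ_apply, ← CF.star_assoc, heg]
    · intro h
      have h1 : e ∈ LinearMap.range (CF.starₗ (FusionSubcategory.top C) g) := by
        rw [h]; exact ⟨e, he⟩
      obtain ⟨x, hx⟩ := h1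
      rw [CF.starₗ_apply] at hx
      have h2 : CF.star g e = e := by rw [← hx, ← CF.star_assoc, hg]
      exact hge (by rw [← h2, hc, heg])
  obtain ⟨L, hL⟩ := key f hef hf hfe
  have hd : CF.star f (e - f) = 0 := by rw [CF.star_sub, hfe', hf, sub_self]
  obtain ⟨L', hL'⟩ := key (e - f) (by rw [CF.star_sub, he, hef])
    (by rw [CF.sub_star, hd, sub_zero, CF.star_sub, he, hef])
    (by simpa using hf0)
  refine ⟨L ∪ L', ?_⟩
  rw [Finset.sum_union, ← hL, ← hL', add_sub_cancel]
  -- A common index `j` would give `F_j = f ⋆ (e - f) ⋆ F_j = 0`.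
  rw [Finset.disjoint_left]
  intro j hj hj'
  have h1 := sum_F_star_F hc L j
  have h2 := sum_F_star_F hc L' j
  rw [if_pos hj, ← hL] at h1
  rw [if_pos hj', ← hL'] at h2
  refine j.2.2.1 (?_ : j.F = 0)
  rw [← h1, ← h2, ← CF.star_assoc, hd, CF.zero_star]

end PrimitiveIdempotents

end FusionCat

open FusionCat
theorem lemma4p24 {C : Type u} [Category.{v} C] [Abelian C] [Linear ℂ C] [MonoidalCategory C]
    [MonoidalPreadditive C] [MonoidalLinear ℂ C] [RigidCategory C] [IsFusionCategory C]
    (a : PivotalStructure C) (ha : a.IsPseudoUnitary)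
    (hcomm : ∀ x y : Gr C ℤ, Gr.mul ℤ x y = Gr.mul ℤ y x)
    (D E : FusionSubcategory C) :
    (∀ K : FusionSubcategory C, ∃! t : CF K, IsIdempotentCointegral t) ∧
    (∀ K : FusionSubcategory C, ∃! L : Finset (PrimIdem C), lam K = ∑ j ∈ L, j.F) ∧
    ∃ h : Function.Bijective (fourierTransform C),
      lam (D.join E) = CF.star (lam D) (lam E) ∧
      ell h (D.join E) = ∑ j ∈ indexSet D ∩ indexSet E, classSum h j ∧
      indexSet (D.join E) = indexSet D ∩ indexSet E := by
  have hc : ∀ f g : CF (FusionSubcategory.top C), CF.star f g = CF.star g f :=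
    star_comm a hcomm
  have hex : ∀ K : FusionSubcategory C, ∃ L : Finset (PrimIdem C), lam K = ∑ j ∈ L, j.F :=
    fun K => exists_eq_sum_F hc _ (lam_star a hcomm fun _ hX => absorbs_lam a hcomm hX)
  have hidx : ∀ K : FusionSubcategory C, lam K = ∑ j ∈ indexSet K, j.F :=
    fun K => Classical.epsilon_spec (hex K)
  have hjoin := lam_join a hcomm D E
  have hsum : lam (D.join E) = ∑ j ∈ indexSet D ∩ indexSet E, j.F := by
    rw [hjoin, hidx D, hidx E, star_sum_F hc]
  refine ⟨existsUnique_isIdempotentCointegral a hcomm, fun K => ?_,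
    bijective_fourierTransform a hcomm, hjoin, ?_, ?_⟩
  · exact ⟨_, hidx K, fun L hL => sum_F_injective hc (hL.symm.trans (hidx K))⟩
  -- Apply the Fourier transform to both sides: it is linear and sends each class sum back to its
  -- idempotent.
  · refine (Equiv.symm_apply_eq _).2 (hsum.trans ?_)
    have h := map_sum (fourierₗ (cointegral (FusionSubcategory.top C)))
      (classSum (bijective_fourierTransform a hcomm)) (indexSet D ∩ indexSet E)
    refine Eq.trans (Finset.sum_congr rfl fun j _ => ?_) h.symm
    exact ((Equiv.ofBijective _ (bijective_fourierTransform a hcomm)).apply_symm_apply j.F).symm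
  · exact sum_F_injective hc ((hidx _).symm.trans hsum)
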